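/- All graphs are finite and simple. For a graph $G=(V,E)$ and $A\subseteq V$ let $I_G(A)$ be the set of edges with both endpoints in $A$, and for $0\le m\le |V|$ let $I_G(m)=\max_{S\subseteq V,\,|S|=m}|I_G(S)|$. A set $A\subseteq V$ is optimal if $|I_G(A)|=I_G(|A|)$. A total order on $V$, written as a bijection $\mathcal O:V\to\{1,\dots,|V|\}$, is optimal for $G$ if each initial segment $\mathcal O^{-1}(\{1,\dots,k\})$ is optimal; $G$ is isoperimetric if it has an optimal order. For $1\le m\le |V|$ put $\delta_G(m)=I_G(m)-I_G(m-1)$. Let $G$ be isoperimetric with optimal order $\mathcal O$. A monotonic set of $G$ is a set $\mathcal O[a,b]=\mathcal O^{-1}(\{a,\dots,b\})$, $1\le a\le b\le |V|$, such that $\delta_G(i+1)-\delta_G(i)=1$ for $a\le i<b$, $\delta_G(a)-\delta_G(a-1)<1$ if $a>1$, and $\delta_G(b+1)-\delta_G(b)<1$ if $b<|V|$. The monotonic sets partition $V$; this is the standard monotonic partition $\mathfrak M_G$. Let $G_1,\dots,G_d$ be isoperimetric graphs with optimal orders $\mathcal O_1,\dots,\mathcal O_d$, and for a nonempty $S=\{i_1<\dots<i_k\}\subseteq\{1,\dots,d\}$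 let $G_S=G_{i_1}\square\cdots\square G_{i_k}$ be the Cartesian product (two vertices are adjacent iff they are adjacent in one coordinate and equal in all others). The blocks of $G_S$ are the sets $\prod_{i\in S}\mathcal O_i[a_i,b_i]$ with $\mathcal O_i[a_i,b_i]\in\mathfrak M_{G_i}$; the start of this block is the vertex $z$ with $\mathcal O_i(z_i)=a_i$ for $i\in S$. The standard block-lexicographic order $\mathcal{SBL}_{G_S}$ is the total order on the vertices of $G_S$ defined as follows. (1) If $u\neq v$ lie in the same block $\prod_{i\in S}\mathcal O_i[a_i,b_i]$, let $n_i=b_i-a_i+1$ and list $S$ as $\eta(1),\dots,\eta(k)$ by increasing $n_i$, ties being broken by increasing $i$. Then $u<v$ iff $\mathcal O_{\eta(j)}(u_{\eta(j)})<\mathcal O_{\eta(j)}(v_{\eta(j)})$ for the least $j$ with $u_{\eta(j)}\ne v_{\eta(j)}$. (2) If $u$ and $v$ lie in different blocks, with starts $z\neq w$, then $u<v$ iff $\mathcal O_i(z_i)<\mathcal O_i(w_i)$ for the least $i\in S$ with $z_i\ne w_i$. **Theorem.** Let $d\ge 3$ and let $G_1,\dots,G_d$ be regular isoperimetric graphs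 (their degrees may differ) with optimal orders $\mathcal O_1,\dots,\mathcal O_d$ and standard monotonic partitions $\mathfrak M_{G_1},\dots,\mathfrak M_{G_d}$. If $\mathcal{SBL}_{G_i\square G_j}$ is optimal for $G_i\square G_j$ for all $1\le i<j\le d$, then $\mathcal{SBL}_{G_1\square\cdots\square G_d}$ is optimal for $G_1\square\cdots\square G_d$. -/

import Mathlib

namespace EdgeIso

noncomputable section

/-- The set `I_G(A)` of edges of `G` both of whose endpoints lie in `A`. -/
def inducedEdges {V : Type*} (G : SimpleGraph V) (A : Finset V) : Set (Sym2 V) :=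
  {e | e ∈ G.edgeSet ∧ ∀ v ∈ e, v ∈ A}

/-- The number `I_G(m)`: the maximum of `|I_G(S)|` over all vertex sets `S` of size `m`
(for `m ≤ |V|`, which is the only case used). -/
def maxInduced {V : Type*} [Fintype V] (G : SimpleGraph V) (m : ℕ) : ℕ :=
  (Finset.powersetCard m (Finset.univ : Finset V)).sup fun S => (inducedEdges G S).ncard

/-- A vertex set is optimal if it induces the maximum number of edges among the sets of its
size. -/
def IsOptimal {V : Type*} [Fintype V] (G : SimpleGraph V) (A : Finset V) : Prop :=
  (inducedEdges G A).ncard = maxInduced G A.card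

/-- A total order on the vertex set, given as a bijection onto an initial piece of `ℕ`. -/
abbrev Numbering (V : Type*) [Fintype V] : Type _ := V ≃ Fin (Fintype.card V)

/-- The position of a vertex in a numbering; positions are `1, …, |V|`. -/
def pos {V : Type*} [Fintype V] (η : Numbering V) (v : V) : ℕ := (η v : ℕ) + 1

/-- The set of the first `k` vertices. -/
def initialSegment {V : Type*} [Fintype V] (η : Numbering V) (k : ℕ) : Finset V :=
  Finset.univ.filter fun v => pos η v ≤ k

/-- The numbering `η` is an optimal order on `G`: all its initial segments are optimal, i.e. they
form a chain of nested solutions. A graph is isoperimetric iff it has an optimal numbering. -/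
def IsOptimalNumbering {V : Type*} [Fintype V] (G : SimpleGraph V) (η : Numbering V) : Prop :=
  ∀ k ≤ Fintype.card V, IsOptimal G (initialSegment η k)

/-- The relation `r` is (the strict part of) a total order on the vertices of `G`, and this total
order is optimal. -/
def IsOptimalOrder {V : Type*} [Fintype V] (G : SimpleGraph V) (r : V → V → Prop) : Prop :=
  ∃ η : Numbering V, IsOptimalNumbering G η ∧ ∀ u v, r u v ↔ pos η u < pos η v

/-- The Cartesian product of a family of graphs: two vertices are adjacent iff they are adjacent
in one coordinate and equal in all the others. -/
def cartesianProduct {ι : Type*} {V : ι → Type*} (G : ∀ i, SimpleGraph (V i)) :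
    SimpleGraph (∀ i, V i) where
  Adj x y := ∃ i, (G i).Adj (x i) (y i) ∧ ∀ j, j ≠ i → x j = y j
  symm := ⟨fun _ _ ⟨i, h, h'⟩ => ⟨i, h.symm, fun j hj => (h' j hj).symm⟩⟩
  loopless := ⟨fun _ ⟨_, h, _⟩ => h.ne rfl⟩

/-- The `δ`-sequence `δ_G(m) = I_G(m) - I_G(m - 1)`, used for `1 ≤ m ≤ |V|`. -/
def delta {V : Type*} [Fintype V] (G : SimpleGraph V) (m : ℕ) : ℤ :=
  (maxInduced G m : ℤ) - maxInduced G (m - 1)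

/-- `δ_G[a, b]` is a monotonic segment: a maximal run of positions along which `δ_G` increases by
one at each step. The case `a = b` is allowed. -/
def IsMonotonicSegment {V : Type*} [Fintype V] (G : SimpleGraph V) (a b : ℕ) : Prop :=
  1 ≤ a ∧ a ≤ b ∧ b ≤ Fintype.card V ∧
  (∀ i, a ≤ i → i < b → delta G (i + 1) - delta G i = 1) ∧
  (1 < a → delta G a - delta G (a - 1) < 1) ∧
  (b < Fintype.card V → delta G (b + 1) - delta G b < 1)

section Product

variable {ι : Type*} {V : ι → Type*} [∀ i, Fintype (V i)]

/-- The tuple `(η_i(v_i))_i` of positions of the coordinates of `v`. -/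
def coords (η : ∀ i, Numbering (V i)) (v : ∀ i, V i) : ι → ℕ := fun i => pos (η i) (v i)

/-- The vertex `v` lies in the block `∏ i, η_i[a_i, b_i]`, each factor of which is a member of the
standard monotonic partition of `G i`. The start of this block has coordinates `a`. -/
def InBlock (G : ∀ i, SimpleGraph (V i)) (η : ∀ i, Numbering (V i)) (a b : ι → ℕ)
    (v : ∀ i, V i) : Prop :=
  ∀ i, IsMonotonicSegment (G i) (a i) (b i) ∧ a i ≤ coords η v i ∧ coords η v i ≤ b i

variable [LinearOrder ι]

/-- The lexicographic order on tuples. -/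
def LexLT (x y : ι → ℕ) : Prop := Pi.Lex (· < ·) (· < ·) x y

/-- The order on the coordinate indices of a block with side lengths `n`: by length, ties being
broken by index. -/
def sideLT (n : ι → ℕ) (i j : ι) : Prop := n i < n j ∨ (n i = n j ∧ i < j)

/-- The domination order that belongs to the standard permutation of a block with side lengths
`n`: tuples are compared lexicographically after the coordinates have been listed from the shortest
side to the longest. -/
def DominationLT (n : ι → ℕ) (x y : ι → ℕ) : Prop := Pi.Lex (sideLT n) (· < ·) x y

/-- The standard block-lexicographic order on the product of the `G i`, for given optimal
numberings `η i`: vertices of one block are compared in the standard domination order of that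
block, and vertices of different blocks by the lexicographic order of the starts. -/
def SBL (G : ∀ i, SimpleGraph (V i)) (η : ∀ i, Numbering (V i)) (u v : ∀ i, V i) : Prop :=
  (∃ a b : ι → ℕ, InBlock G η a b u ∧ InBlock G η a b v ∧
    DominationLT (fun i => b i + 1 - a i) (coords η u) (coords η v)) ∨
  (∃ a b a' b' : ι → ℕ, InBlock G η a b u ∧ InBlock G η a' b' v ∧
    (a, b) ≠ (a', b') ∧ LexLT a a')

end Product

end

end EdgeIso

namespace EdgeIso
open scoped Classical

/-! ### Edges counted as ordered pairs. -/

section Counting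

variable {V : Type*}

/-! By induction on the number of factors, it suffices to treat a product of at least three factors
in which deleting any one factor leaves an optimal block order (`isOptimalOrder_of_rest`). Among the
sets of a given size with the most edges, take the set `A` with the least sum of positions; the goal
is that `A` is an initial segment.

Replacing every slice of `A` by an initial segment loses no edges, so all slices already are initial
segments (`slice_eq`). Hence a bad pair, `u ∉ A`, `v ∈ A`, `u < v`, differs in every coordinate
(`not_sbl_of_eq`). With three factors this is strong: adjacent points of a slice agree in a further
coordinate, so certain edges between early missing points and late present points cannot exist, and
late points can be moved to early places in another slice at no cost inside the slices
(`adjCount_add_le`).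

The edges between slices must survive too. If the blocks of `u` and `v` have the same start in some
coordinate `j`, the points move between two slices of one monotonic segment, where later vertices
have more earlier neighbours (`false_of_segment_eq`). If all starts differ, `u` lies over the last
and `v` over the first segment of the second factor. Regularity makes these two segments mirror
images of each other, and both are cliques, so simultaneous exchanges between mirror slices lose
nothing (`false_of_mirror`). Each exchange lowers the sum of positions, a contradiction. -/

/-- The number of ordered pairs of adjacent vertices of `A`. -/
noncomputable def adjCount (G : SimpleGraph V) (A : Finset V) : ℕ :=
  ∑ x ∈ A, ∑ y ∈ A, if G.Adj x y then 1 else 0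

/-- The handshake identity in the induced subgraph. It replaces edge sets by double sums, which
split well over unions and products. -/
theorem adjCount_eq_two_mul_ncard [Fintype V] (G : SimpleGraph V) (A : Finset V) :
    adjCount G A = 2 * (inducedEdges G A).ncard := by
  have h1 := (G.induce (A : Set V)).sum_degrees_eq_twice_card_edges
  have h2 : (G.induce (A : Set V)).edgeFinset.card = (inducedEdges G A).ncard := by
    rw [← Set.ncard_coe_finset, SimpleGraph.coe_edgeFinset]
    refine Set.ncard_congr (fun e _ => e.map Subtype.val) ?_ ?_ ?_
    · intro e
      induction e with
      | _ x y =>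
        intro h
        simp only [SimpleGraph.mem_edgeSet, SimpleGraph.comap_adj, Function.Embedding.subtype_apply]
          at h
        simp only [inducedEdges, Sym2.map_mk, Set.mem_ofPred_eq, SimpleGraph.mem_edgeSet,
          Sym2.mem_iff]
        refine ⟨h, ?_⟩
        rintro v (rfl | rfl)
        · exact x.2
        · exact y.2
    · intro e f _ _ h
      exact Sym2.map.injective Subtype.val_injective h
    · intro e
      induction e with
      | _ x y =>
        rintro ⟨h, hm⟩
        have hx := hm x (Sym2.mem_mk_left x y)
        have hy := hm y (Sym2.mem_mk_right x y)
        exact ⟨s(⟨x, hx⟩, ⟨y, hy⟩), by simpa using h, by simp⟩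
  rw [← h2, ← h1, adjCount, ← Finset.sum_coe_sort A]
  refine Finset.sum_congr rfl fun x _ => ?_
  rw [← Finset.sum_coe_sort A, ← SimpleGraph.card_neighborFinset_eq_degree, Finset.card_eq_sum_ones,
    SimpleGraph.neighborFinset_eq_filter, Finset.sum_filter]
  refine Finset.sum_congr rfl fun y _ => ?_
  simp

theorem adjCount_union_of_disjoint [DecidableEq V] (G : SimpleGraph V) {A B : Finset V}
    (h : Disjoint A B) :
    adjCount G (A ∪ B) = adjCount G A + adjCount G B +
      2 * ∑ x ∈ A, ∑ y ∈ B, if G.Adj x y then 1 else 0 := by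
  unfold adjCount
  rw [Finset.sum_union h]
  simp only [Finset.sum_union h, Finset.sum_add_distrib]
  have : ∑ x ∈ B, ∑ y ∈ A, (if G.Adj x y then 1 else 0) =
      ∑ x ∈ A, ∑ y ∈ B, if G.Adj x y then 1 else 0 := by
    rw [Finset.sum_comm]
    simp only [G.adj_comm]
  omega

theorem adjCount_singleton (G : SimpleGraph V) (x : V) : adjCount G {x} = 0 := by
  simp [adjCount]

end Counting

/-! ### Numberings, initial segments and optimality. -/

section Numberings

variable {V : Type*} [Fintype V]

theorem pos_injective (η : Numbering V) : Function.Injective (pos η) := fun x y h => by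
  apply η.injective
  apply Fin.ext
  simpa [pos] using h

theorem one_le_pos (η : Numbering V) (x : V) : 1 ≤ pos η x := by simp [pos]

theorem pos_le_card (η : Numbering V) (x : V) : pos η x ≤ Fintype.card V := (η x).2

theorem exists_pos_eq (η : Numbering V) {m : ℕ} (h1 : 1 ≤ m) (h2 : m ≤ Fintype.card V) :
    ∃ x, pos η x = m :=
  ⟨η.symm ⟨m - 1, by omega⟩, by simp [pos]; omega⟩

theorem mem_initialSegment (η : Numbering V) (k : ℕ) (x : V) :
    x ∈ initialSegment η k ↔ pos η x ≤ k := by simp [initialSegment]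

theorem card_initialSegment (η : Numbering V) {k : ℕ} (hk : k ≤ Fintype.card V) :
    (initialSegment η k).card = k := by
  have : (initialSegment η k).image (pos η) = Finset.Icc 1 k := by
    ext m
    simp only [Finset.mem_image, mem_initialSegment, Finset.mem_Icc]
    constructor
    · rintro ⟨x, hx, rfl⟩
      exact ⟨one_le_pos η x, hx⟩
    · rintro ⟨h1, h2⟩
      obtain ⟨x, hx⟩ := exists_pos_eq η h1 (h2.trans hk)
      exact ⟨x, hx ▸ h2, hx⟩
  rw [← Finset.card_image_of_injective _ (pos_injective η), this]
  simp

theorem initialSegment_subset (η : Numbering V) {k l : ℕ} (h : k ≤ l) :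
    initialSegment η k ⊆ initialSegment η l := fun x hx => by
  rw [mem_initialSegment] at *
  omega

theorem initialSegment_inter [DecidableEq V] (η : Numbering V) (k l : ℕ) :
    initialSegment η k ∩ initialSegment η l = initialSegment η (min k l) := by
  ext x
  simp [mem_initialSegment]

theorem maxInduced_ge (G : SimpleGraph V) (A : Finset V) :
    (inducedEdges G A).ncard ≤ maxInduced G A.card :=
  Finset.le_sup (f := fun S => (inducedEdges G S).ncard)
    (Finset.mem_powersetCard.2 ⟨Finset.subset_univ A, rfl⟩)

theorem isOptimal_iff (G : SimpleGraph V) (A : Finset V) :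
    IsOptimal G A ↔ ∀ B : Finset V, B.card = A.card → adjCount G B ≤ adjCount G A := by
  constructor
  · intro h B hB
    rw [adjCount_eq_two_mul_ncard, adjCount_eq_two_mul_ncard, h, ← hB]
    exact Nat.mul_le_mul_left 2 (maxInduced_ge G B)
  · intro h
    refine le_antisymm (maxInduced_ge G A) (Finset.sup_le fun B hB => ?_)
    have := h B (Finset.mem_powersetCard.1 hB).2
    rw [adjCount_eq_two_mul_ncard, adjCount_eq_two_mul_ncard] at this
    omega

theorem isOptimalNumbering_iff (G : SimpleGraph V) (η : Numbering V) :
    IsOptimalNumbering G η ↔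
      ∀ B : Finset V, adjCount G B ≤ adjCount G (initialSegment η B.card) := by
  constructor
  · intro h B
    have hB : B.card ≤ Fintype.card V := Finset.card_le_univ B
    exact (isOptimal_iff G _).1 (h _ hB) B (card_initialSegment η hB).symm
  · intro h k hk
    rw [isOptimal_iff]
    intro B hB
    rw [card_initialSegment η hk] at hB
    exact hB ▸ h B

end Numberings

/-! ### The sequence `delta`: growth and reflection. -/

section Delta

variable {V : Type*} [Fintype V] {G : SimpleGraph V} {η : Numbering V}

/-- The number of neighbours of `x` that precede it. -/
noncomputable def backDegree (G : SimpleGraph V) (η : Numbering V) (x : V) : ℕ :=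
  ∑ y, if G.Adj x y ∧ pos η y < pos η x then 1 else 0

theorem initialSegment_pos (η : Numbering V) (x : V) :
    initialSegment η (pos η x) = initialSegment η (pos η x - 1) ∪ {x} := by
  ext y
  have := one_le_pos η x
  simp only [mem_initialSegment, Finset.mem_union, Finset.mem_singleton]
  rw [← (pos_injective η).eq_iff]
  omega

theorem disjoint_initialSegment_singleton (η : Numbering V) (x : V) :
    Disjoint (initialSegment η (pos η x - 1)) {x} := by
  have := one_le_pos η x
  rw [Finset.disjoint_singleton_right, mem_initialSegment]
  omega

theorem adjCount_initialSegment_pos (G : SimpleGraph V) (η : Numbering V) (x : V) :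
    adjCount G (initialSegment η (pos η x)) =
      adjCount G (initialSegment η (pos η x - 1)) + 2 * backDegree G η x := by
  rw [initialSegment_pos, adjCount_union_of_disjoint G (disjoint_initialSegment_singleton η x),
    adjCount_singleton, add_zero, backDegree]
  congr 2
  simp only [Finset.sum_singleton]
  rw [initialSegment, Finset.sum_filter]
  refine Finset.sum_congr rfl fun y _ => ?_
  have := one_le_pos η x
  rw [G.adj_comm]
  by_cases h : pos η y < pos η x
  · rw [if_pos (by omega)]; simp [h]
  · rw [if_neg (by omega)]; simp [h]

theorem two_mul_maxInduced (hη : IsOptimalNumbering G η) {k : ℕ} (hk : k ≤ Fintype.card V) :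
    2 * maxInduced G k = adjCount G (initialSegment η k) := by
  rw [adjCount_eq_two_mul_ncard, hη k hk, card_initialSegment η hk]

theorem delta_pos (hη : IsOptimalNumbering G η) (x : V) :
    delta G (pos η x) = backDegree G η x := by
  have h1 := two_mul_maxInduced hη (pos_le_card η x)
  have h2 := two_mul_maxInduced hη (k := pos η x - 1) (by have := pos_le_card η x; omega)
  have h3 := adjCount_initialSegment_pos G η x
  unfold delta
  omega

/-- Delete `x`, instead of the last vertex `y`, from the initial segment ending at `y`. What remains
has no more edges than the optimal set of that size, so `x` has at least `delta G (pos η y)`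
neighbours in the segment. -/
theorem delta_le_backDegree_add (hη : IsOptimalNumbering G η) {x y : V} (h : pos η x < pos η y) :
    delta G (pos η y) ≤ delta G (pos η x) +
      ∑ z, if G.Adj x z ∧ pos η x < pos η z ∧ pos η z ≤ pos η y then 1 else 0 := by
  have hy := pos_le_card η y
  set S := initialSegment η (pos η y) with hS
  have hxS : x ∈ S := by rw [hS, mem_initialSegment]; omega
  have hcard : (S.erase x).card = pos η y - 1 := by
    rw [Finset.card_erase_of_mem hxS, card_initialSegment η hy]
  have h1 := (isOptimalNumbering_iff G η).1 hη (S.erase x)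
  rw [hcard] at h1
  have h2 := adjCount_union_of_disjoint G (A := {x}) (B := S.erase x)
    (by simp)
  have h3 : ({x} : Finset V) ∪ S.erase x = S := by
    rw [← Finset.insert_eq, Finset.insert_erase hxS]
  rw [h3, adjCount_singleton] at h2
  have h4 := adjCount_initialSegment_pos G η y
  rw [← hS] at h4
  have h5 : (∑ a ∈ ({x} : Finset V), ∑ z ∈ S.erase x, if G.Adj a z then 1 else 0) =
      backDegree G η x +
        ∑ z, if G.Adj x z ∧ pos η x < pos η z ∧ pos η z ≤ pos η y then 1 else 0 := by
    rw [Finset.sum_singleton, backDegree, ← Finset.sum_add_distrib]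
    have : S.erase x = Finset.univ.filter fun z => pos η z ≤ pos η y ∧ z ≠ x := by
      ext z
      simp [hS, mem_initialSegment, and_comm]
    rw [this, Finset.sum_filter]
    refine Finset.sum_congr rfl fun z _ => ?_
    by_cases ha : G.Adj x z
    · have hne : pos η z ≠ pos η x := fun e => ha.ne ((pos_injective η e).symm)
      have hne' : z ≠ x := ha.ne'
      simp only [ha, true_and, hne', ne_eq, not_false_eq_true, and_true]
      split_ifs <;> omega
    · simp [ha]
  rw [delta_pos hη y, delta_pos hη x]
  rw [h5] at h2
  have h6 : (backDegree G η y : ℤ) ≤ ((backDegree G η x + ∑ z, if G.Adj x z ∧ pos η x < pos η z ∧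
      pos η z ≤ pos η y then 1 else 0 : ℕ) : ℤ) := by
    rw [Nat.cast_le]
    omega
  push_cast at h6
  exact h6

theorem card_between (η : Numbering V) {a b : ℕ} (hb : b ≤ Fintype.card V) :
    (Finset.univ.filter fun z => a < pos η z ∧ pos η z ≤ b).card = b - a := by
  have : (Finset.univ.filter fun z => a < pos η z ∧ pos η z ≤ b).image (pos η) =
      Finset.Icc (a + 1) b := by
    ext m
    simp only [Finset.mem_image, Finset.mem_filter, Finset.mem_univ, true_and, Finset.mem_Icc]
    constructor
    · rintro ⟨x, hx, rfl⟩
      exact hx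
    · rintro ⟨h1, h2⟩
      obtain ⟨x, hx⟩ := exists_pos_eq η (by omega : 1 ≤ m) (h2.trans hb)
      exact ⟨x, by omega, hx⟩
  rw [← Finset.card_image_of_injective _ (pos_injective η), this]
  simp

theorem delta_sub_le (hη : IsOptimalNumbering G η) {x y : V} (h : pos η x < pos η y) :
    delta G (pos η y) ≤ delta G (pos η x) + (pos η y - pos η x : ℕ) := by
  refine (delta_le_backDegree_add hη h).trans ?_
  rw [← card_between η (pos_le_card η y), Finset.card_eq_sum_ones, Finset.sum_filter]
  push_cast
  gcongr with z
  split_ifs <;> simp_all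

/-- Equality in `delta_sub_le` forces every vertex after `x` up to `y` to be a neighbour of `x`. -/
theorem adj_of_delta_eq (hη : IsOptimalNumbering G η) {x y : V} (h : pos η x < pos η y)
    (hd : delta G (pos η y) = delta G (pos η x) + (pos η y - pos η x : ℕ)) : G.Adj x y := by
  by_contra hadj
  have h1 := delta_le_backDegree_add hη h
  rw [hd, ← card_between η (pos_le_card η y), Finset.card_eq_sum_ones, Finset.sum_filter] at h1
  push_cast at h1
  have h2 : (∑ z, if G.Adj x z ∧ pos η x < pos η z ∧ pos η z ≤ pos η y then (1 : ℤ) else 0) <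
      ∑ z, if pos η x < pos η z ∧ pos η z ≤ pos η y then (1 : ℤ) else 0 := by
    refine Finset.sum_lt_sum (fun z _ => ?_) ⟨y, Finset.mem_univ y, ?_⟩
    · split_ifs <;> simp_all
    · simp [hadj, h]
  linarith

theorem delta_succ_le (hη : IsOptimalNumbering G η) {m : ℕ} (h1 : 1 ≤ m)
    (h2 : m + 1 ≤ Fintype.card V) : delta G (m + 1) - delta G m ≤ 1 := by
  obtain ⟨x, hx⟩ := exists_pos_eq η h1 (by omega)
  obtain ⟨y, hy⟩ := exists_pos_eq η (by omega) h2
  have := delta_sub_le hη (x := x) (y := y) (by omega)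
  rw [hx, hy] at this
  simp at this
  omega

/-- All vertices have `k` neighbours. -/
def HasDegree (G : SimpleGraph V) (k : ℕ) : Prop := ∀ x, (∑ y, if G.Adj x y then 1 else 0) = k

/-- The degree sum over `A` determines the number of edges leaving `A`; the rest is the total degree
sum. -/
theorem adjCount_compl {k : ℕ} (hk : HasDegree G k) (A : Finset V) :
    adjCount G Aᶜ + 2 * (k * A.card) = k * Fintype.card V + adjCount G A := by
  have hu : A ∪ Aᶜ = Finset.univ := Finset.union_compl A
  have h1 := adjCount_union_of_disjoint G (A := A) (B := Aᶜ) disjoint_compl_right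
  have h2 : adjCount G Finset.univ = k * Fintype.card V := by
    unfold adjCount
    simp only [hk _, Finset.sum_const, Finset.card_univ, smul_eq_mul, mul_comm]
  have h3 : adjCount G A + ∑ x ∈ A, ∑ y ∈ Aᶜ, (if G.Adj x y then 1 else 0) = k * A.card := by
    unfold adjCount
    rw [← Finset.sum_add_distrib]
    have : ∀ x ∈ A, ((∑ y ∈ A, if G.Adj x y then 1 else 0) +
        ∑ y ∈ Aᶜ, if G.Adj x y then 1 else 0) = k := fun x _ => by
      rw [← hk x, ← Finset.sum_union disjoint_compl_right, hu]
    rw [Finset.sum_congr rfl this]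
    simp [mul_comm]
  rw [hu, h2] at h1
  omega

/-- Regularity ties the edges of a set to those of its complement. Comparing complements of initial
segments with optimal sets gives one inequality; applying it to both `m` and `|V| - m` gives
equality. -/
theorem adjCount_initialSegment_sub {k : ℕ} (hk : HasDegree G k) (hη : IsOptimalNumbering G η)
    {m : ℕ} (hm : m ≤ Fintype.card V) :
    adjCount G (initialSegment η (Fintype.card V - m)) + 2 * (k * m) =
      k * Fintype.card V + adjCount G (initialSegment η m) := by
  have key : ∀ l ≤ Fintype.card V, k * Fintype.card V + adjCount G (initialSegment η l) ≤
      adjCount G (initialSegment η (Fintype.card V - l)) + 2 * (k * l) := fun l hl => by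
    have h1 := adjCount_compl hk (initialSegment η l)
    have h2 := (isOptimalNumbering_iff G η).1 hη (initialSegment η l)ᶜ
    rw [Finset.card_compl, card_initialSegment η hl] at h2
    rw [card_initialSegment η hl] at h1
    omega
  have h1 := key m hm
  have h2 := key (Fintype.card V - m) (by omega)
  rw [Nat.sub_sub_self hm, Nat.mul_sub] at h2
  have : k * m ≤ k * Fintype.card V := Nat.mul_le_mul_left k hm
  omega

theorem delta_reflect {k : ℕ} (hk : HasDegree G k) (hη : IsOptimalNumbering G η) {m : ℕ}
    (h1 : 1 ≤ m) (h2 : m ≤ Fintype.card V) :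
    delta G (Fintype.card V + 1 - m) = k - delta G m := by
  have e1 := adjCount_initialSegment_sub hk hη h2
  have e2 := adjCount_initialSegment_sub hk hη (m := m - 1) (by omega)
  rw [← two_mul_maxInduced hη (by omega), ← two_mul_maxInduced hη (by omega)] at e1 e2
  unfold delta
  have e3 : Fintype.card V + 1 - m - 1 = Fintype.card V - m := by omega
  have e4 : Fintype.card V + 1 - m = Fintype.card V - (m - 1) := by omega
  rw [e3, e4]
  obtain ⟨l, rfl⟩ : ∃ l, m = l + 1 := ⟨m - 1, by omega⟩
  simp only [Nat.add_sub_cancel] at *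
  rw [Nat.mul_add] at e1
  omega

end Delta

/-! ### Monotonic segments: partition, cliques and mirror symmetry. -/

section Segments

variable {V : Type*} [Fintype V] {G : SimpleGraph V} {η : Numbering V}

theorem exists_isMonotonicSegment (hη : IsOptimalNumbering G η) {m : ℕ} (h1 : 1 ≤ m)
    (h2 : m ≤ Fintype.card V) :
    ∃ s : ℕ × ℕ, IsMonotonicSegment G s.1 s.2 ∧ s.1 ≤ m ∧ m ≤ s.2 := by
  -- The run around `m` extends right to the first failure of the unit step and left to the least
  -- start of an unbroken run.
  have hb : ∃ b, m ≤ b ∧ (b = Fintype.card V ∨ delta G (b + 1) - delta G b ≠ 1) :=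
    ⟨_, h2, Or.inl rfl⟩
  have ha : ∃ a, 1 ≤ a ∧ a ≤ m ∧ ∀ i, a ≤ i → i < m → delta G (i + 1) - delta G i = 1 :=
    ⟨m, h1, le_rfl, fun i hi hi' => by omega⟩
  obtain ⟨ha1, ham, ha3⟩ := Nat.find_spec ha
  obtain ⟨hbm, hb2⟩ := Nat.find_spec hb
  have ha4 := fun a (h : a < Nat.find ha) => Nat.find_min ha h
  have hb4 := fun b (h : b < Nat.find hb) => Nat.find_min hb h
  generalize Nat.find ha = a at *
  generalize Nat.find hb = b at *
  have hbn : b ≤ Fintype.card V := by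
    by_contra h
    exact hb4 (Fintype.card V) (by omega) ⟨h2, Or.inl rfl⟩
  refine ⟨(a, b), ⟨ha1, ham.trans hbm, hbn, fun i hi hib => ?_, fun h => ?_, fun h => ?_⟩, ham, hbm⟩
  · rcases lt_or_ge i m with him | him
    · exact ha3 i hi him
    · by_contra hne
      exact hb4 i hib ⟨him, Or.inr hne⟩
  · refine lt_of_le_of_ne ?_ fun he => ?_
    · have := delta_succ_le hη (m := a - 1) (by omega) (by omega)
      rwa [Nat.sub_add_cancel (by omega)] at this
    · refine ha4 (a - 1) (by omega) ⟨by omega, by omega, fun i hi him => ?_⟩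
      rcases eq_or_lt_of_le hi with rfl | hi
      · rwa [Nat.sub_add_cancel (by omega)]
      · exact ha3 i (by omega) him
  · exact lt_of_le_of_ne (delta_succ_le hη (by omega) (by omega)) (hb2.resolve_left (by omega))

theorem IsMonotonicSegment.unique {a b a' b' m : ℕ} (h : IsMonotonicSegment G a b)
    (h' : IsMonotonicSegment G a' b') (ha : a ≤ m) (hb : m ≤ b) (ha' : a' ≤ m) (hb' : m ≤ b') :
    a = a' ∧ b = b' := by
  have key1 : ∀ {a b a' b' : ℕ}, IsMonotonicSegment G a b → IsMonotonicSegment G a' b' →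
      m ≤ b → a' ≤ m → ¬ a < a' := by
    intro a b a' b' h h' hb ha' hlt
    have h1 := h'.2.2.2.2.1 (by have := h.1; omega)
    have h2 := h.2.2.2.1 (a' - 1) (by omega) (by omega)
    rw [Nat.sub_add_cancel (by omega)] at h2
    omega
  have key2 : ∀ {a b a' b' : ℕ}, IsMonotonicSegment G a b → IsMonotonicSegment G a' b' →
      m ≤ b → a' ≤ m → ¬ b < b' := by
    intro a b a' b' h h' hb ha' hlt
    have h1 := h.2.2.2.2.2 (by have := h'.2.2.1; omega)
    have h2 := h'.2.2.2.1 b (by omega) (by omega)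
    omega
  have := key1 h h' hb ha'
  have := key1 h' h hb' ha
  have := key2 h h' hb ha'
  have := key2 h' h hb' ha
  omega

theorem IsMonotonicSegment.delta_eq {a b : ℕ} (h : IsMonotonicSegment G a b) {m m' : ℕ}
    (ha : a ≤ m) (hm : m ≤ m') (hb : m' ≤ b) : delta G m' = delta G m + (m' - m : ℕ) := by
  induction m', hm using Nat.le_induction with
  | base => simp
  | succ l hl ih =>
    have := h.2.2.2.1 l (by omega) (by omega)
    have := ih (by omega)
    omega

theorem IsMonotonicSegment.reflect {k : ℕ} (hk : HasDegree G k) (hη : IsOptimalNumbering G η)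
    {a b : ℕ} (h : IsMonotonicSegment G a b) :
    IsMonotonicSegment G (Fintype.card V + 1 - b) (Fintype.card V + 1 - a) := by
  obtain ⟨h1, h2, h3, h4, h5, h6⟩ := h
  have key : ∀ i j, 1 ≤ i → i ≤ Fintype.card V → i + j = Fintype.card V + 1 →
      delta G j = k - delta G i := by
    intro i j hi hi' hij
    rw [← delta_reflect hk hη hi hi']
    congr 1
    omega
  refine ⟨by omega, by omega, by omega, fun i hi hib => ?_, fun h => ?_, fun h => ?_⟩
  · have := h4 (Fintype.card V - i) (by omega) (by omega)
    rw [key (Fintype.card V - i) (i + 1) (by omega) (by omega) (by omega),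
      key (Fintype.card V - i + 1) i (by omega) (by omega) (by omega)]
    omega
  · have := h6 (by omega)
    rw [key b (Fintype.card V + 1 - b) (by omega) (by omega) (by omega),
      key (b + 1) (Fintype.card V + 1 - b - 1) (by omega) (by omega) (by omega)]
    omega
  · have := h5 (by omega)
    rw [key a (Fintype.card V + 1 - a) (by omega) (by omega) (by omega),
      key (a - 1) (Fintype.card V + 1 - a + 1) (by omega) (by omega) (by omega)]
    omega

/-- The end points of the monotonic segment that contains the position of a vertex. -/
noncomputable def segment (G : SimpleGraph V) (η : Numbering V) (x : V) : ℕ × ℕ :=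
  -- The default value does not occur for an optimal numbering, by `segment_spec`.
  if h : ∃ s : ℕ × ℕ, IsMonotonicSegment G s.1 s.2 ∧ s.1 ≤ pos η x ∧ pos η x ≤ s.2 then h.choose
  else (0, 0)

theorem segment_spec (hη : IsOptimalNumbering G η) (x : V) :
    IsMonotonicSegment G (segment G η x).1 (segment G η x).2 ∧
      (segment G η x).1 ≤ pos η x ∧ pos η x ≤ (segment G η x).2 := by
  have h := exists_isMonotonicSegment hη (one_le_pos η x) (pos_le_card η x)
  rw [segment, dif_pos h]
  exact h.choose_spec

theorem segment_eq (hη : IsOptimalNumbering G η) {x : V} {a b : ℕ}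
    (h : IsMonotonicSegment G a b) (ha : a ≤ pos η x) (hb : pos η x ≤ b) :
    segment G η x = (a, b) := by
  obtain ⟨h1, h2, h3⟩ := segment_spec hη x
  exact Prod.ext_iff.2 (h1.unique h h2 h3 ha hb)

theorem segment_eq_of_fst_eq (hη : IsOptimalNumbering G η) {x y : V}
    (h : (segment G η x).1 = (segment G η y).1) : segment G η x = segment G η y := by
  obtain ⟨h1, h2, h3⟩ := segment_spec hη x
  obtain ⟨h4, h5, h6⟩ := segment_spec hη y
  exact Prod.ext_iff.2 (h1.unique h4 (m := (segment G η x).1) le_rfl (by omega) (by omega)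
    (by omega))

theorem segment_fst_mono (hη : IsOptimalNumbering G η) {x y : V} (h : pos η x ≤ pos η y) :
    (segment G η x).1 ≤ (segment G η y).1 := by
  obtain ⟨h1, h2, h3⟩ := segment_spec hη x
  obtain ⟨h4, h5, h6⟩ := segment_spec hη y
  by_contra hlt
  have := h1.unique h4 (m := pos η x) h2 h3 (by omega) (by omega)
  omega

theorem segment_fst_eq_of_between (hη : IsOptimalNumbering G η) {x y z : V}
    (h : (segment G η x).1 = (segment G η z).1) (h1 : pos η x ≤ pos η y) (h2 : pos η y ≤ pos η z) :
    (segment G η y).1 = (segment G η x).1 :=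
  le_antisymm (h ▸ segment_fst_mono hη h2) (segment_fst_mono hη h1)

/-- Along a segment `delta` grows as fast as it can, so the equality case applies to any two of its
vertices: segments are cliques. -/
theorem adj_of_segment_eq (hη : IsOptimalNumbering G η) {x y : V} (hne : x ≠ y)
    (h : (segment G η x).1 = (segment G η y).1) : G.Adj x y := by
  have key : ∀ {x y : V}, (segment G η x).1 = (segment G η y).1 → pos η x < pos η y →
      G.Adj x y := by
    intro x y h hlt
    obtain ⟨h1, h2, h3⟩ := segment_spec hη x
    obtain ⟨h4, h5, h6⟩ := segment_spec hη y
    rw [segment_eq_of_fst_eq hη h] at h1 h2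
    exact adj_of_delta_eq hη hlt (h1.delta_eq h2 hlt.le h6)
  rcases lt_trichotomy (pos η x) (pos η y) with hlt | heq | hlt
  · exact key h hlt
  · exact absurd (pos_injective η heq) hne
  · exact (key h.symm hlt).symm

theorem backDegree_le_of_segment_eq (hη : IsOptimalNumbering G η) {x y : V}
    (h : (segment G η x).1 = (segment G η y).1) (hlt : pos η x ≤ pos η y) :
    backDegree G η x ≤ backDegree G η y := by
  obtain ⟨h1, h2, h3⟩ := segment_spec hη x
  obtain ⟨h4, h5, h6⟩ := segment_spec hη y
  rw [segment_eq_of_fst_eq hη h] at h1 h2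
  have := h1.delta_eq h2 hlt h6
  rw [delta_pos hη, delta_pos hη] at this
  omega

/-- The vertex at the mirror image of the position of `x`. -/
def mirror (η : Numbering V) (x : V) : V := η.symm (η x).rev

theorem mirror_mirror (η : Numbering V) (x : V) : mirror η (mirror η x) = x := by simp [mirror]

theorem mirror_injective (η : Numbering V) : Function.Injective (mirror η) :=
  Function.LeftInverse.injective (mirror_mirror η)

theorem pos_mirror (η : Numbering V) (x : V) :
    pos η (mirror η x) = Fintype.card V + 1 - pos η x := by
  have := (η x).2
  simp only [pos, mirror, Equiv.apply_symm_apply, Fin.val_rev]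
  omega

theorem segment_mirror {k : ℕ} (hk : HasDegree G k) (hη : IsOptimalNumbering G η) (x : V) :
    segment G η (mirror η x) =
      (Fintype.card V + 1 - (segment G η x).2, Fintype.card V + 1 - (segment G η x).1) := by
  obtain ⟨h1, h2, h3⟩ := segment_spec hη x
  apply segment_eq hη (h1.reflect hk hη)
  · rw [pos_mirror]; omega
  · rw [pos_mirror]; omega

end Segments

/-! ### Lexicographic comparison of tuples. -/

section Lex

variable {ι : Type*} {r : ι → ι → Prop} {x y z : ι → ℕ}

theorem lex_irrefl : ¬ Pi.Lex r (· < ·) x x := fun ⟨_, _, h⟩ => lt_irrefl _ h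

theorem lex_trans (ht : ∀ {i j k}, r i j → r j k → r i k) (hr : ∀ i j, r i j ∨ i = j ∨ r j i)
    (h : Pi.Lex r (· < ·) x y) (h' : Pi.Lex r (· < ·) y z) : Pi.Lex r (· < ·) x z := by
  obtain ⟨i, hi, hxy⟩ := h
  obtain ⟨j, hj, hyz⟩ := h'
  rcases hr i j with hij | rfl | hji
  · exact ⟨i, fun k hk => (hi k hk).trans (hj k (ht hk hij)), by rwa [← hj i hij]⟩
  · exact ⟨i, fun k hk => (hi k hk).trans (hj k hk), lt_trans hxy hyz⟩
  · exact ⟨j, fun k hk => (hi k (ht hk hji)).trans (hj k hk), by rwa [hi j hji]⟩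

theorem lex_trichotomous [Finite ι] (ht : ∀ {i j k}, r i j → r j k → r i k) (hn : ∀ i, ¬ r i i)
    (hne : x ≠ y) :
    Pi.Lex r (· < ·) x y ∨ Pi.Lex r (· < ·) y x := by
  have : IsTrans ι r := ⟨fun _ _ _ => ht⟩
  have : Std.Irrefl r := ⟨hn⟩
  have hw : WellFounded r := Finite.wellFounded_of_trans_of_irrefl r
  obtain ⟨i, hi, hmin⟩ := hw.has_min {i | x i ≠ y i} (Function.ne_iff.1 hne)
  have hmin' : ∀ j, r j i → x j = y j := fun j hj => by
    by_contra h
    exact hmin j h hj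
  rcases lt_or_gt_of_ne hi with h | h
  · exact Or.inl ⟨i, hmin', h⟩
  · exact Or.inr ⟨i, fun j hj => (hmin' j hj).symm, h⟩

/-- A coordinate outside the range of `f` cannot be the deciding one, since the tuples agree there.
-/
theorem lex_comp_iff {κ : Type*} {f : κ → ι} {r' : κ → κ → Prop}
    (hr : ∀ a b, r' a b ↔ r (f a) (f b)) (h : ∀ i, i ∉ Set.range f → x i = y i) :
    Pi.Lex r' (· < ·) (fun k => x (f k)) (fun k => y (f k)) ↔ Pi.Lex r (· < ·) x y := by
  constructor
  · rintro ⟨a, ha, hlt⟩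
    refine ⟨f a, fun j hj => ?_, hlt⟩
    by_cases hjf : j ∈ Set.range f
    · obtain ⟨b, rfl⟩ := hjf
      exact ha b ((hr b a).2 hj)
    · exact h j hjf
  · rintro ⟨i, hi, hlt⟩
    obtain ⟨a, rfl⟩ : i ∈ Set.range f := by
      by_contra hif
      exact hlt.ne (h i hif)
    exact ⟨a, fun b hb => hi (f b) ((hr b a).1 hb), hlt⟩

variable [LinearOrder ι] {n : ι → ℕ}

theorem sideLT_trans {i j k : ι} (h : sideLT n i j) (h' : sideLT n j k) : sideLT n i k := by
  unfold sideLT at *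
  rcases h with h | ⟨h, hi⟩ <;> rcases h' with h' | ⟨h', hi'⟩
  · exact Or.inl (h.trans h')
  · exact Or.inl (by omega)
  · exact Or.inl (by omega)
  · exact Or.inr ⟨h.trans h', hi.trans hi'⟩

theorem sideLT_irrefl (i : ι) : ¬ sideLT n i i := by simp [sideLT]

theorem sideLT_trichotomous (i j : ι) : sideLT n i j ∨ i = j ∨ sideLT n j i := by
  unfold sideLT
  rcases lt_trichotomy (n i) (n j) with h | h | h <;> rcases lt_trichotomy i j with h' | h' | h' <;>
    simp [h, h']

end Lex

/-! ### The block-lexicographic order. -/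

section Order

variable {ι : Type*} {V : ι → Type*} [∀ i, Fintype (V i)]
  {G : ∀ i, SimpleGraph (V i)} {η : ∀ i, Numbering (V i)}

/-- The coordinates of the start of the block that contains `x`. -/
noncomputable def starts (G : ∀ i, SimpleGraph (V i)) (η : ∀ i, Numbering (V i)) (x : ∀ i, V i) :
    ι → ℕ := fun i => (segment (G i) (η i) (x i)).1

/-- The side lengths of the block that contains `x`. -/
noncomputable def sides (G : ∀ i, SimpleGraph (V i)) (η : ∀ i, Numbering (V i)) (x : ∀ i, V i) :
    ι → ℕ := fun i => (segment (G i) (η i) (x i)).2 + 1 - (segment (G i) (η i) (x i)).1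

theorem sides_eq (hη : ∀ i, IsOptimalNumbering (G i) (η i)) {u v : ∀ i, V i}
    (h : starts G η u = starts G η v) : sides G η u = sides G η v := by
  funext i
  rw [sides, segment_eq_of_fst_eq (hη i) (congrFun h i), sides]

variable [LinearOrder ι]

/-- The block of a point is unique, so the existential description of the order becomes one in terms
of `starts`, `sides` and `coords`. -/
theorem sbl_iff (hη : ∀ i, IsOptimalNumbering (G i) (η i)) (u v : ∀ i, V i) :
    SBL G η u v ↔ LexLT (starts G η u) (starts G η v) ∨
      (starts G η u = starts G η v ∧
        DominationLT (sides G η u) (coords η u) (coords η v)) := by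
  have hseg : ∀ {a b x}, InBlock G η a b x → ∀ i, segment (G i) (η i) (x i) = (a i, b i) :=
    fun h i => segment_eq (hη i) (h i).1 (h i).2.1 (h i).2.2
  have hblock : ∀ x, InBlock G η (starts G η x) (fun i => (segment (G i) (η i) (x i)).2) x :=
    fun x i => segment_spec (hη i) (x i)
  have hst : ∀ {a b x}, InBlock G η a b x → starts G η x = a := fun h => by
    funext i
    rw [starts, hseg h i]
  constructor
  · rintro (⟨a, b, hu, hv, h⟩ | ⟨a, b, a', b', hu, hv, -, h⟩)
    · refine Or.inr ⟨(hst hu).trans (hst hv).symm, ?_⟩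
      have : sides G η u = fun i => b i + 1 - a i := by
        funext i
        rw [sides, hseg hu i]
      rwa [this]
    · exact Or.inl (by rwa [hst hu, hst hv])
  · rintro (h | ⟨h, hd⟩)
    · refine Or.inr ⟨_, _, _, _, hblock u, hblock v, fun he => ?_, h⟩
      have he' : starts G η u = starts G η v := congrArg Prod.fst he
      rw [he'] at h
      exact lex_irrefl h
    · refine Or.inl ⟨_, _, hblock u, ?_, hd⟩
      have h2 : (fun i => (segment (G i) (η i) (u i)).2) =
          fun i => (segment (G i) (η i) (v i)).2 := by
        funext i
        rw [segment_eq_of_fst_eq (hη i) (congrFun h i)]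
      rw [h, h2]
      exact hblock v

theorem sbl_irrefl (hη : ∀ i, IsOptimalNumbering (G i) (η i)) (u : ∀ i, V i) :
    ¬ SBL G η u u := by
  rw [sbl_iff hη]
  rintro (h | ⟨-, h⟩) <;> exact lex_irrefl h

theorem sbl_trans (hη : ∀ i, IsOptimalNumbering (G i) (η i)) {u v w : ∀ i, V i}
    (h : SBL G η u v) (h' : SBL G η v w) : SBL G η u w := by
  rw [sbl_iff hη] at *
  rcases h with h | ⟨h, hd⟩ <;> rcases h' with h' | ⟨h', hd'⟩
  · exact Or.inl (lex_trans lt_trans lt_trichotomy h h')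
  · exact Or.inl (h' ▸ h)
  · exact Or.inl (h ▸ h')
  · refine Or.inr ⟨h.trans h', lex_trans sideLT_trans sideLT_trichotomous hd ?_⟩
    rw [sides_eq hη h]
    exact hd'

theorem sbl_trichotomous [Finite ι] (hη : ∀ i, IsOptimalNumbering (G i) (η i)) {u v : ∀ i, V i}
    (hne : u ≠ v) : SBL G η u v ∨ SBL G η v u := by
  rw [sbl_iff hη, sbl_iff hη]
  by_cases h : starts G η u = starts G η v
  · have hc : coords η u ≠ coords η v := fun hc => hne <| by
      funext i
      exact pos_injective (η i) (congrFun hc i)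
    have := lex_trichotomous (r := sideLT (sides G η u)) sideLT_trans sideLT_irrefl hc
    unfold DominationLT
    rw [← sides_eq hη h]
    tauto
  · have := lex_trichotomous (r := fun i j : ι => i < j) lt_trans lt_irrefl h
    unfold LexLT
    tauto

/-- Consistency of the order: common coordinates may be dropped. This relates the order of a slice
to that of the whole product. -/
theorem sbl_comp_iff {κ : Type*} [LinearOrder κ] (hη : ∀ i, IsOptimalNumbering (G i) (η i))
    (f : κ ↪o ι) {u v : ∀ i, V i} (h : ∀ i, i ∉ Set.range f → u i = v i) :
    SBL (fun k => G (f k)) (fun k => η (f k)) (fun k => u (f k)) (fun k => v (f k)) ↔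
      SBL G η u v := by
  rw [sbl_iff hη, sbl_iff fun k => hη (f k)]
  have hs : ∀ i, i ∉ Set.range f → starts G η u i = starts G η v i := fun i hi => by
    simp [starts, h i hi]
  have hc : ∀ i, i ∉ Set.range f → coords η u i = coords η v i := fun i hi => by
    simp [coords, h i hi]
  have h1 := lex_comp_iff (f := f) (r := fun i j : ι => i < j) (r' := fun i j : κ => i < j)
    (fun a b => f.lt_iff_lt.symm) hs
  have h2 := lex_comp_iff (f := f) (r := sideLT (sides G η u))
    (r' := sideLT (fun k => sides G η u (f k))) (fun a b => by simp [sideLT]) hc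
  have h3 : (∀ k, starts G η u (f k) = starts G η v (f k)) ↔ starts G η u = starts G η v := by
    constructor
    · intro h
      funext i
      by_cases hi : i ∈ Set.range f
      · obtain ⟨k, rfl⟩ := hi
        exact h k
      · exact hs i hi
    · intro h k
      rw [h]
  exact or_congr h1 (and_congr (funext_iff.trans h3) h2)

theorem sbl_of_starts_lt (hη : ∀ i, IsOptimalNumbering (G i) (η i)) {u v : ∀ i, V i}
    (h : LexLT (starts G η u) (starts G η v)) : SBL G η u v := (sbl_iff hη u v).2 (Or.inl h)

theorem sbl_of_pos_lt (hη : ∀ i, IsOptimalNumbering (G i) (η i)) {u v : ∀ i, V i} {j : ι}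
    (h : ∀ i, i ≠ j → u i = v i) (hj : pos (η j) (u j) < pos (η j) (v j)) : SBL G η u v := by
  rw [sbl_iff hη]
  have hs : ∀ i, i ≠ j → starts G η u i = starts G η v i := fun i hi => by simp [starts, h i hi]
  have hle : starts G η u j ≤ starts G η v j := segment_fst_mono (hη j) hj.le
  rcases hle.lt_or_eq with hlt | heq
  · exact Or.inl ⟨j, fun i hi => hs i hi.ne, hlt⟩
  · refine Or.inr ⟨?_, j, fun i hi => ?_, hj⟩
    · funext i
      by_cases hi : i = j
      · rw [hi, heq]
      · exact hs i hi
    · have : i ≠ j := fun e => sideLT_irrefl j (e ▸ hi)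
      simp [coords, h i this]

end Order

theorem exists_numbering {W : Type*} [Fintype W] {r : W → W → Prop} (hn : ∀ u, ¬ r u u)
    (ht : ∀ {u v w}, r u v → r v w → r u w) (hr : ∀ {u v}, u ≠ v → r u v ∨ r v u) :
    ∃ ζ : Numbering W, ∀ u v, r u v ↔ pos ζ u < pos ζ v := by
  have : IsTrans W r := ⟨fun _ _ _ => ht⟩
  have : Std.Irrefl r := ⟨hn⟩
  have : Std.Trichotomous r := ⟨fun u v h h' => by
    by_contra hne
    exact (hr hne).elim h h'⟩
  have : IsStrictTotalOrder W r := {}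
  let : LinearOrder W := linearOrderOfSTO r
  refine ⟨(monoEquivOfFin W rfl).symm.toEquiv, fun u v => ?_⟩
  have : u < v ↔ (monoEquivOfFin W rfl).symm u < (monoEquivOfFin W rfl).symm v :=
    (OrderIso.lt_iff_lt _).symm
  simp only [pos]
  rw [Nat.add_lt_add_iff_right]
  exact this

/-! ### Transport of optimal orders along isomorphisms. -/

section Transfer

variable {W W' : Type*}

theorem adjCount_map (e : W ≃ W') {H : SimpleGraph W} {H' : SimpleGraph W'}
    (hadj : ∀ u v, H'.Adj (e u) (e v) ↔ H.Adj u v) (A : Finset W) :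
    adjCount H' (A.map e.toEmbedding) = adjCount H A := by
  simp only [adjCount, Finset.sum_map, Equiv.coe_toEmbedding, hadj]

theorem IsOptimalOrder.transfer [Fintype W] [Fintype W'] (e : W ≃ W')
    {H : SimpleGraph W} {H' : SimpleGraph W'} {r : W → W → Prop} {r' : W' → W' → Prop}
    (hadj : ∀ u v, H'.Adj (e u) (e v) ↔ H.Adj u v)
    (hr : ∀ u v, r' (e u) (e v) ↔ r u v) (h : IsOptimalOrder H r) : IsOptimalOrder H' r' := by
  obtain ⟨ζ, hζ, hζr⟩ := h
  let ζ' : Numbering W' := (e.symm.trans ζ).trans (finCongr (Fintype.card_congr e))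
  have hpos : ∀ u, pos ζ' (e u) = pos ζ u := fun u => by simp [pos, ζ']
  refine ⟨ζ', (isOptimalNumbering_iff _ _).2 fun B => ?_, fun u v => ?_⟩
  · have h1 := (isOptimalNumbering_iff _ _).1 hζ (B.map e.symm.toEmbedding)
    rw [Finset.card_map, adjCount_map (H := H') (H' := H) e.symm (fun u v => by rw [← hadj]; simp),
      ← adjCount_map e hadj] at h1
    convert h1 using 2
    ext u
    obtain ⟨u, rfl⟩ := e.surjective u
    simp [mem_initialSegment, hpos]
  · obtain ⟨u, rfl⟩ := e.surjective u
    obtain ⟨v, rfl⟩ := e.surjective v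
    rw [hr, hζr, hpos, hpos]

end Transfer

/-! ### Slices of a subset of the product. -/

section Slices

variable {ι : Type*} [LinearOrder ι] {V : ι → Type*}

/-- The tuple of the coordinates of `x` other than `x j`. -/
def rest (j : ι) (x : ∀ i, V i) : ∀ k : {k // k ≠ j}, V k := fun k => x k

/-- The vertex with `j`-th coordinate `p` and the other coordinates given by `a`. -/
def ins (j : ι) (p : V j) (a : ∀ k : {k // k ≠ j}, V k) : ∀ i, V i :=
  (Equiv.piSplitAt j V).symm (p, a)

theorem ins_self (j : ι) (p : V j) (a : ∀ k : {k // k ≠ j}, V k) : ins j p a j = p := by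
  simp [ins]

theorem ins_of_ne {j k : ι} (h : k ≠ j) (p : V j) (a : ∀ k : {k // k ≠ j}, V k) :
    ins j p a k = a ⟨k, h⟩ := by
  simp [ins, h]

theorem rest_ins (j : ι) (p : V j) (a : ∀ k : {k // k ≠ j}, V k) : rest j (ins j p a) = a := by
  funext k
  exact ins_of_ne k.2 p a

theorem ins_rest (j : ι) (x : ∀ i, V i) : ins j (x j) (rest j x) = x :=
  (Equiv.piSplitAt j V).symm_apply_apply x

theorem cartesianProduct_adj_ins (G : ∀ i, SimpleGraph (V i)) {j : ι} (p q : V j)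
    (a b : ∀ k : {k // k ≠ j}, V k) :
    (cartesianProduct G).Adj (ins j p a) (ins j q b) ↔
      ((G j).Adj p q ∧ a = b) ∨
      (p = q ∧ (cartesianProduct fun k : {k // k ≠ j} => G k).Adj a b) := by
  constructor
  · rintro ⟨i, h, h'⟩
    by_cases hi : i = j
    · subst hi
      rw [ins_self, ins_self] at h
      refine Or.inl ⟨h, funext fun k => ?_⟩
      simpa [ins_of_ne k.2] using h' k k.2
    · rw [ins_of_ne hi, ins_of_ne hi] at h
      refine Or.inr ⟨?_, ⟨i, hi⟩, h, fun k hk => ?_⟩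
      · simpa [ins_self] using h' j (Ne.symm hi)
      · simpa [ins_of_ne k.2] using h' k fun e => hk (Subtype.ext e)
  · rintro (⟨h, rfl⟩ | ⟨rfl, k, h, h'⟩)
    · refine ⟨j, by rwa [ins_self, ins_self], fun i hi => ?_⟩
      rw [ins_of_ne hi, ins_of_ne hi]
    · refine ⟨k, by rwa [ins_of_ne k.2, ins_of_ne k.2], fun i hi => ?_⟩
      by_cases hij : i = j
      · subst hij
        rw [ins_self, ins_self]
      · rw [ins_of_ne hij, ins_of_ne hij]
        exact h' ⟨i, hij⟩ fun e => hi (congrArg Subtype.val e)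

variable [Fintype ι] [∀ i, Fintype (V i)]

/-- The slice of `A` at the `j`-th coordinate `p`. -/
noncomputable def slice (j : ι) (A : Finset (∀ i, V i)) (p : V j) :
    Finset (∀ k : {k // k ≠ j}, V k) := Finset.univ.filter fun a => ins j p a ∈ A

theorem mem_slice {j : ι} {A : Finset (∀ i, V i)} {p : V j} {a : ∀ k : {k // k ≠ j}, V k} :
    a ∈ slice j A p ↔ ins j p a ∈ A := by simp [slice]

theorem rest_mem_slice {j : ι} {A : Finset (∀ i, V i)} {x : ∀ i, V i} :
    rest j x ∈ slice j A (x j) ↔ x ∈ A := by rw [mem_slice, ins_rest]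

theorem sum_eq_sum_slice {M : Type*} [AddCommMonoid M] (j : ι) (A : Finset (∀ i, V i))
    (f : (∀ i, V i) → M) : ∑ x ∈ A, f x = ∑ p, ∑ a ∈ slice j A p, f (ins j p a) := by
  have h1 : ∑ x ∈ A, f x = ∑ x, if x ∈ A then f x else 0 := by
    rw [← Finset.sum_filter]
    simp
  rw [h1, ← (Equiv.piSplitAt j V).symm.sum_comp, Fintype.sum_prod_type]
  refine Finset.sum_congr rfl fun p _ => ?_
  rw [slice, Finset.sum_filter]
  rfl

theorem card_eq_sum_slice (j : ι) (A : Finset (∀ i, V i)) :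
    A.card = ∑ p, (slice j A p).card := by
  simp only [Finset.card_eq_sum_ones]
  exact sum_eq_sum_slice j A _

/-- An edge either lies in one slice or runs in direction `j`; the latter join equal points of two
slices over adjacent vertices of `G j`. -/
theorem adjCount_eq_sum_slice (G : ∀ i, SimpleGraph (V i)) (j : ι) (A : Finset (∀ i, V i)) :
    adjCount (cartesianProduct G) A =
      ∑ p, adjCount (cartesianProduct fun k : {k // k ≠ j} => G k) (slice j A p) +
      ∑ p, ∑ q, if (G j).Adj p q then (slice j A p ∩ slice j A q).card else 0 := by
  have hsum : ∀ p q : V j, ∀ a b : ∀ k : {k // k ≠ j}, V k,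
      (if (cartesianProduct G).Adj (ins j p a) (ins j q b) then 1 else 0) =
        (if (G j).Adj p q then (if a = b then 1 else 0) else 0) +
        (if p = q then (if (cartesianProduct fun k : {k // k ≠ j} => G k).Adj a b then 1 else 0)
          else 0) := by
    intro p q a b
    rw [if_congr (cartesianProduct_adj_ins G p q a b) rfl rfl]
    by_cases hpq : p = q
    · subst hpq
      simp
    · by_cases h : (G j).Adj p q <;> simp [hpq, h]
  rw [adjCount, sum_eq_sum_slice j A, ← Finset.sum_add_distrib]
  refine Finset.sum_congr rfl fun p _ => ?_
  simp only [sum_eq_sum_slice j A, hsum, Finset.sum_add_distrib]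
  rw [add_comm]
  congr 1
  · rw [adjCount]
    refine Finset.sum_congr rfl fun a _ => ?_
    rw [Finset.sum_eq_single p (fun q _ hq => by simp [hq.symm]) (by simp)]
    simp
  · rw [Finset.sum_comm]
    refine Finset.sum_congr rfl fun q _ => ?_
    by_cases h : (G j).Adj p q
    · simp only [h, if_true]
      simp only [Finset.sum_ite_eq]
      rw [← Finset.filter_mem_eq_inter, Finset.card_filter]
    · simp [h]

end Slices

/-! ### Auxiliary sums and comparisons. -/

theorem exists_ne_ne {ι : Type*} [Fintype ι] (h3 : 3 ≤ Fintype.card ι) (j l : ι) :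
    ∃ k, k ≠ j ∧ k ≠ l := by
  by_contra! h
  have h1 : (Finset.univ : Finset ι) ⊆ {j, l} := fun k _ => by
    rw [Finset.mem_insert, Finset.mem_singleton]
    exact or_iff_not_imp_left.2 (h k)
  have h2 := (Finset.card_le_card h1).trans Finset.card_le_two
  rw [Finset.card_univ] at h2
  omega

theorem sum_lt_sum_of_exchange {W : Type*} {f : W → ℕ} {A B : Finset W} (hcard : B.card = A.card)
    (h : ∀ y ∈ B, y ∉ A → ∀ x ∈ A, x ∉ B → f y < f x) (hne : B ≠ A) :
    ∑ x ∈ B, f x < ∑ x ∈ A, f x := by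
  rw [← Finset.sum_inter_add_sum_sdiff B A f, ← Finset.sum_inter_add_sum_sdiff A B f,
    Finset.inter_comm]
  have hc : (B \ A).card = (A \ B).card := by
    have h1 := Finset.card_sdiff_add_card_inter B A
    have h2 := Finset.card_sdiff_add_card_inter A B
    rw [Finset.inter_comm] at h2
    omega
  have hpos : (B \ A).Nonempty := by
    rw [Finset.nonempty_iff_ne_empty]
    intro h0
    have h1 : B ⊆ A := Finset.sdiff_eq_empty_iff_subset.1 h0
    exact hne (Finset.eq_of_subset_of_card_le h1 hcard.ge)
  obtain ⟨y, hy, hmax⟩ := Finset.exists_max_image (B \ A) f hpos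
  have h1 : ∑ x ∈ B \ A, f x ≤ (B \ A).card * f y := by
    rw [← smul_eq_mul]
    exact Finset.sum_le_card_nsmul _ _ _ hmax
  have h2 : (A \ B).card * (f y + 1) ≤ ∑ x ∈ A \ B, f x := by
    rw [← smul_eq_mul]
    refine Finset.card_nsmul_le_sum _ _ _ fun x hx => ?_
    rw [Finset.mem_sdiff] at hx hy
    exact h y hy.1 hy.2 x hx.1 hx.2
  have h3 := hpos.card_pos
  rw [← hc, Nat.mul_add] at h2
  omega

theorem sum_initialSegment_lt {W : Type*} [Fintype W] {ζ : Numbering W} {f : W → ℕ}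
    (hf : ∀ a b, pos ζ a < pos ζ b → f a < f b) {S : Finset W}
    (hne : initialSegment ζ S.card ≠ S) :
    ∑ x ∈ initialSegment ζ S.card, f x < ∑ x ∈ S, f x := by
  refine sum_lt_sum_of_exchange (card_initialSegment ζ (Finset.card_le_univ S)) ?_ hne
  intro y hy _ x _ hx
  rw [mem_initialSegment] at hy hx
  exact hf y x (by omega)

/-- As `M` decreases along `ζ`, the minimum on an edge is the value at its later end; charge the
edge there. -/
theorem sum_adj_min_eq {W : Type*} [Fintype W] {H : SimpleGraph W} {ζ : Numbering W} {M : W → ℕ}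
    (hM : ∀ p q, pos ζ p ≤ pos ζ q → M q ≤ M p) :
    (∑ p, ∑ q, if H.Adj p q then min (M p) (M q) else 0) = 2 * ∑ p, M p * backDegree H ζ p := by
  have h1 : ∀ p q, (if H.Adj p q then min (M p) (M q) else 0) =
      (if H.Adj p q ∧ pos ζ q < pos ζ p then M p else 0) +
      (if H.Adj q p ∧ pos ζ p < pos ζ q then M q else 0) := by
    intro p q
    by_cases h : H.Adj p q
    · have hne : pos ζ p ≠ pos ζ q := fun e => h.ne (pos_injective ζ e)
      rcases lt_or_gt_of_ne hne with hlt | hlt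
      · simp [h, h.symm, hlt, hM p q hlt.le, not_lt.2 hlt.le]
      · simp [h, h.symm, hlt, hM q p hlt.le, not_lt.2 hlt.le]
    · have h' : ¬ H.Adj q p := fun h' => h h'.symm
      simp [h, h']
  have h2 : ∀ p, (∑ q, if H.Adj p q ∧ pos ζ q < pos ζ p then M p else 0) =
      M p * backDegree H ζ p := by
    intro p
    rw [backDegree, Finset.mul_sum]
    simp
  simp only [h1, Finset.sum_add_distrib]
  rw [Finset.sum_comm (f := fun p q => if H.Adj q p ∧ pos ζ p < pos ζ q then M q else 0)]
  simp only [h2]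
  omega

section

variable {ι : Type*} [LinearOrder ι] {V : ι → Type*} [∀ i, Fintype (V i)]

theorem sbl_iff_rest {G : ∀ i, SimpleGraph (V i)} {η : ∀ i, Numbering (V i)}
    (hη : ∀ i, IsOptimalNumbering (G i) (η i)) {j : ι} {x y : ∀ i, V i} (h : x j = y j) :
    SBL (fun k : {k // k ≠ j} => G k) (fun k : {k // k ≠ j} => η k) (rest j x) (rest j y) ↔
      SBL G η x y := by
  refine sbl_comp_iff hη (OrderEmbedding.subtype fun k => k ≠ j) fun i hi => ?_
  have : i = j := by
    by_contra hij
    exact hi ⟨⟨i, hij⟩, rfl⟩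
  rw [this, h]

end

/-! ### Extremal sets: initial segments as slices, and the exchange principle. -/

section

variable {ι : Type*} [LinearOrder ι] [Fintype ι] {V : ι → Type*} [∀ i, Fintype (V i)]

/-- The set whose slices at the coordinate `j` are initial segments of the sizes given by `M`. -/
noncomputable def profile (j : ι) (ζ : Numbering (∀ k : {k // k ≠ j}, V k)) (M : V j → ℕ) :
    Finset (∀ i, V i) := Finset.univ.filter fun x => pos ζ (rest j x) ≤ M (x j)

theorem slice_profile (j : ι) (ζ : Numbering (∀ k : {k // k ≠ j}, V k)) (M : V j → ℕ) (p : V j) :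
    slice j (profile j ζ M) p = initialSegment ζ (M p) := by
  ext a
  simp [mem_slice, profile, mem_initialSegment, rest_ins, ins_self]

theorem card_profile {j : ι} {ζ : Numbering (∀ k : {k // k ≠ j}, V k)} {M : V j → ℕ}
    (hM : ∀ p, M p ≤ Fintype.card (∀ k : {k // k ≠ j}, V k)) :
    (profile j ζ M).card = ∑ p, M p := by
  rw [card_eq_sum_slice j]
  simp only [slice_profile, card_initialSegment ζ (hM _)]

theorem adjCount_profile (G : ∀ i, SimpleGraph (V i)) {j : ι}
    {ζ : Numbering (∀ k : {k // k ≠ j}, V k)} {M : V j → ℕ}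
    (hM : ∀ p, M p ≤ Fintype.card (∀ k : {k // k ≠ j}, V k)) :
    adjCount (cartesianProduct G) (profile j ζ M) =
      ∑ p, adjCount (cartesianProduct fun k : {k // k ≠ j} => G k) (initialSegment ζ (M p)) +
      ∑ p, ∑ q, if (G j).Adj p q then min (M p) (M q) else 0 := by
  rw [adjCount_eq_sum_slice G j]
  simp only [slice_profile, initialSegment_inter]
  congr 1
  refine Finset.sum_congr rfl fun p _ => Finset.sum_congr rfl fun q _ => ?_
  rw [card_initialSegment ζ ((min_le_left _ _).trans (hM p))]

/-- A set with the maximum number of edges among the sets of its size and, subject to this, as early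
as possible in the block-lexicographic order, for a product all of whose subproducts with one factor
less have an optimal block-lexicographic order. -/
structure ExtremalSet (G : ∀ i, SimpleGraph (V i)) (η : ∀ i, Numbering (V i)) where
  optimal : ∀ i, IsOptimalNumbering (G i) (η i)
  /-- the numberings of the subproducts -/
  num : ∀ j : ι, Numbering (∀ k : {k // k ≠ j}, V k)
  num_optimal : ∀ j : ι, IsOptimalNumbering (cartesianProduct fun k : {k // k ≠ j} => G k) (num j)
  num_lt : ∀ (j : ι) (a b : ∀ k : {k // k ≠ j}, V k),
    SBL (fun k : {k // k ≠ j} => G k) (fun k : {k // k ≠ j} => η k) a b ↔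
    pos (num j) a < pos (num j) b
  /-- the numbering of the whole product -/
  all : Numbering (∀ i, V i)
  all_lt : ∀ x y, SBL G η x y ↔ pos all x < pos all y
  /-- the set -/
  A : Finset (∀ i, V i)
  max : ∀ B : Finset (∀ i, V i), B.card = A.card →
    adjCount (cartesianProduct G) B ≤ adjCount (cartesianProduct G) A
  min : ∀ B : Finset (∀ i, V i), B.card = A.card →
    adjCount (cartesianProduct G) A ≤ adjCount (cartesianProduct G) B →
    ∑ x ∈ A, pos all x ≤ ∑ x ∈ B, pos all x
  card_index : 3 ≤ Fintype.card ι

namespace ExtremalSet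

variable {G : ∀ i, SimpleGraph (V i)} {η : ∀ i, Numbering (V i)} (E : ExtremalSet G η)

/-- The size of the slice at the `j`-th coordinate `p`. -/
noncomputable def size (j : ι) (p : V j) : ℕ := (slice j E.A p).card

theorem size_le (j : ι) (p : V j) : E.size j p ≤ Fintype.card (∀ k : {k // k ≠ j}, V k) :=
  Finset.card_le_univ _

theorem num_rest_lt {j : ι} {x y : ∀ i, V i} (h : x j = y j) :
    pos (E.num j) (rest j x) < pos (E.num j) (rest j y) ↔ SBL G η x y := by
  rw [← E.num_lt, sbl_iff_rest E.optimal h]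

/-- Compression: initial segments maximise the edges inside slices, and being nested they maximise
the intersections of slices. If the set changed, its sum of positions would drop. -/
theorem slice_eq (j : ι) (p : V j) : slice j E.A p = initialSegment (E.num j) (E.size j p) := by
  by_contra hne
  set B := profile j (E.num j) (E.size j) with hB
  have hcard : B.card = E.A.card := by
    rw [card_profile (E.size_le j), card_eq_sum_slice j E.A]
    rfl
  have hadj : adjCount (cartesianProduct G) E.A ≤ adjCount (cartesianProduct G) B := by
    rw [adjCount_profile G (E.size_le j), adjCount_eq_sum_slice G j E.A]
    refine Nat.add_le_add (Finset.sum_le_sum fun q _ => ?_)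
      (Finset.sum_le_sum fun q _ => Finset.sum_le_sum fun q' _ => ?_)
    · exact (isOptimalNumbering_iff _ _).1 (E.num_optimal j) _
    · split_ifs
      · exact le_min (Finset.card_le_card Finset.inter_subset_left)
          (Finset.card_le_card Finset.inter_subset_right)
      · exact le_rfl
  have hle := E.min B hcard hadj
  rw [sum_eq_sum_slice j E.A, sum_eq_sum_slice j B] at hle
  refine absurd hle (not_le.2 ?_)
  simp only [hB, slice_profile]
  have hf : ∀ q a b, pos (E.num j) a < pos (E.num j) b →
      pos E.all (ins j q a) < pos E.all (ins j q b) := by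
    intro q a b hab
    rw [← E.all_lt, ← E.num_rest_lt (j := j) (by rw [ins_self, ins_self]), rest_ins, rest_ins]
    exact hab
  refine Finset.sum_lt_sum (fun q _ => ?_) ⟨p, Finset.mem_univ p, ?_⟩
  · by_cases hq : initialSegment (E.num j) (slice j E.A q).card = slice j E.A q
    · rw [size, hq]
    · exact (sum_initialSegment_lt (f := fun a => pos E.all (ins j q a)) (hf q) hq).le
  · exact sum_initialSegment_lt (f := fun a => pos E.all (ins j p a)) (hf p) (Ne.symm hne)

theorem mem_iff (j : ι) (x : ∀ i, V i) :
    x ∈ E.A ↔ pos (E.num j) (rest j x) ≤ E.size j (x j) := by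
  rw [← rest_mem_slice (j := j), slice_eq, mem_initialSegment]

theorem profile_size (j : ι) : profile j (E.num j) (E.size j) = E.A := by
  ext x
  rw [E.mem_iff j]
  simp [profile]

theorem not_sbl_of_eq {u v : ∀ i, V i} (hu : u ∉ E.A) (hv : v ∈ E.A) {k : ι} (hk : u k = v k) :
    ¬ SBL G η u v := by
  rw [← E.num_rest_lt hk]
  rw [E.mem_iff k] at hu hv
  rw [hk] at hu
  omega

/-- Two points differing only in coordinate `j` share another coordinate, so `not_sbl_of_eq`
compares them and the slices are nested. -/
theorem size_anti (j : ι) {p q : V j} (h : pos (η j) p ≤ pos (η j) q) :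
    E.size j q ≤ E.size j p := by
  rcases h.eq_or_lt with h | h
  · rw [pos_injective _ h]
  refine Finset.card_le_card fun a ha => ?_
  rw [mem_slice] at *
  by_contra hp
  obtain ⟨k, hk, -⟩ := exists_ne_ne E.card_index j j
  refine E.not_sbl_of_eq hp ha (k := k) (by rw [ins_of_ne hk, ins_of_ne hk]) ?_
  refine sbl_of_pos_lt E.optimal (j := j) (fun i hi => by rw [ins_of_ne hi, ins_of_ne hi]) ?_
  rwa [ins_self, ins_self]

/-- The set cannot be improved by changing the sizes of its slices. -/
theorem false_of_exchange (j : ι) (Z : ℕ) (M : V j → ℕ)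
    (hM : ∀ p, M p ≤ Fintype.card (∀ k : {k // k ≠ j}, V k))
    (hsum : ∑ p, M p = ∑ p, E.size j p)
    (hlow : ∀ p, M p < E.size j p → Z ≤ M p) (hup : ∀ p, E.size j p < M p → M p ≤ Z)
    (hlt : ∀ p q a b, M p < E.size j p → E.size j q < M q → pos (E.num j) a ≤ Z →
      Z < pos (E.num j) b → SBL G η (ins j q a) (ins j p b))
    (hrest : ∑ p, adjCount (cartesianProduct fun k : {k // k ≠ j} => G k)
        (initialSegment (E.num j) (E.size j p)) ≤
      ∑ p, adjCount (cartesianProduct fun k : {k // k ≠ j} => G k)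
        (initialSegment (E.num j) (M p)))
    (hadj : (∑ p, ∑ q, if (G j).Adj p q then Min.min (E.size j p) (E.size j q) else 0) ≤
      ∑ p, ∑ q, if (G j).Adj p q then Min.min (M p) (M q) else 0)
    (hne : ∃ p, M p ≠ E.size j p) : False := by
  set B := profile j (E.num j) M with hB
  have hcard : B.card = E.A.card := by
    rw [card_profile hM, hsum, ← card_profile (E.size_le j), profile_size]
  have hle : adjCount (cartesianProduct G) E.A ≤ adjCount (cartesianProduct G) B := by
    rw [← E.profile_size j, adjCount_profile G (E.size_le j), adjCount_profile G hM]
    exact Nat.add_le_add hrest hadj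
  -- Gained points lie at rank at most `Z` in their slice and lost points above `Z`, so `hlt` puts
  -- every gained point before every lost one.
  refine absurd (E.min B hcard hle) (not_le.2 (sum_lt_sum_of_exchange hcard ?_ ?_))
  · intro y hy hyA x hx hxB
    simp only [hB, profile, Finset.mem_filter, Finset.mem_univ, true_and] at hy hxB
    rw [E.mem_iff j] at hyA hx
    rw [← E.all_lt, ← ins_rest j y, ← ins_rest j x]
    have h1 := hlow (x j) (by omega)
    have h2 := hup (y j) (by omega)
    exact hlt _ _ _ _ (by omega) (by omega) (by omega) (by omega)
  · intro hBA
    obtain ⟨p, hp⟩ := hne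
    have h1 := congrArg (fun S => (slice j S p).card) hBA
    simp only [hB, slice_profile] at h1
    rw [card_initialSegment _ (hM p)] at h1
    exact hp h1

/-- Let `C` be the part of the slice at `p` above `Z`. No edge joins `C` to the ranks between
`E.size j q` and `Z`: its ends would agree in a coordinate `k ≠ j`, giving a missing point before a
present one with a common coordinate. So attaching `C` to the slice at `q`, instead of to the first
`Z` points, keeps its edges, and optimality of initial segments finishes. -/
theorem adjCount_add_le (j : ι) {Z : ℕ} {p q : V j} (hq : E.size j q ≤ Z) (hp : Z ≤ E.size j p)
    (hlt : ∀ a b, pos (E.num j) a ≤ Z → Z < pos (E.num j) b →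
      SBL G η (ins j q a) (ins j p b)) :
    adjCount (cartesianProduct fun k : {k // k ≠ j} => G k)
        (initialSegment (E.num j) (E.size j p)) +
      adjCount (cartesianProduct fun k : {k // k ≠ j} => G k)
        (initialSegment (E.num j) (E.size j q)) ≤
    adjCount (cartesianProduct fun k : {k // k ≠ j} => G k)
        (initialSegment (E.num j) (E.size j p + E.size j q - Z)) +
      adjCount (cartesianProduct fun k : {k // k ≠ j} => G k)
        (initialSegment (E.num j) Z) := by
  have hN := E.size_le j p
  set H := cartesianProduct fun k : {k // k ≠ j} => G k with hH
  set I := initialSegment (E.num j) with hI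
  set C := I (E.size j p) \ I Z with hC
  have hZp : I Z ⊆ I (E.size j p) := initialSegment_subset _ hp
  have hqZ : I (E.size j q) ⊆ I Z := initialSegment_subset _ hq
  have hd1 : Disjoint (I Z) C := Finset.disjoint_sdiff
  have hd2 : Disjoint (I (E.size j q)) C := hd1.mono_left hqZ
  have h1 := adjCount_union_of_disjoint H hd1
  rw [hC, Finset.union_sdiff_of_subset hZp, ← hC] at h1
  have h2 := adjCount_union_of_disjoint H hd2
  have h3 : (∑ x ∈ I (E.size j q), ∑ y ∈ C, if H.Adj x y then 1 else 0) =
      ∑ x ∈ I Z, ∑ y ∈ C, if H.Adj x y then 1 else 0 := by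
    refine Finset.sum_subset hqZ fun a ha ha' => Finset.sum_eq_zero fun b hb => if_neg ?_
    rintro ⟨l, -, hl⟩
    obtain ⟨k, hkj, hkl⟩ := exists_ne_ne E.card_index j l
    rw [hC, Finset.mem_sdiff, hI, mem_initialSegment, mem_initialSegment] at hb
    rw [hI, mem_initialSegment] at ha ha'
    have hu : ins j q a ∉ E.A := by
      rwa [E.mem_iff j, rest_ins, ins_self]
    have hv : ins j p b ∈ E.A := by
      rw [E.mem_iff j, rest_ins, ins_self]
      exact hb.1
    refine E.not_sbl_of_eq hu hv (k := k) ?_ (hlt a b ha (not_le.1 hb.2))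
    rw [ins_of_ne hkj, ins_of_ne hkj]
    exact hl ⟨k, hkj⟩ fun e => hkl (congrArg Subtype.val e)
  have h4 : adjCount H (I (E.size j q) ∪ C) ≤ adjCount H (I (I (E.size j q) ∪ C).card) :=
    (isOptimalNumbering_iff _ _).1 (E.num_optimal j) _
  have h5 : (I (E.size j q) ∪ C).card = E.size j p + E.size j q - Z := by
    rw [Finset.card_union_of_disjoint hd2, hC, Finset.card_sdiff_of_subset hZp, hI,
      card_initialSegment _ hN, card_initialSegment _ (by omega), card_initialSegment _ (by omega)]
    omega
  rw [h5] at h4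
  omega

end ExtremalSet
end

/-! ### The two exchanges between slices. -/

theorem sum_eq_pair_add {W : Type*} [Fintype W] (f : W → ℕ) {p q : W} (hpq : p ≠ q) :
    ∑ x, f x = f p + f q + ∑ x ∈ (Finset.univ.erase p).erase q, f x := by
  rw [← Finset.add_sum_erase Finset.univ f (Finset.mem_univ p),
    ← Finset.add_sum_erase (Finset.univ.erase p) f
      (Finset.mem_erase.2 ⟨hpq.symm, Finset.mem_univ q⟩), add_assoc]

theorem sum_le_sum_of_pair {W : Type*} [Fintype W] {f g : W → ℕ} {p q : W} (hpq : p ≠ q)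
    (h : ∀ x, x ≠ p → x ≠ q → f x = g x) (h' : f p + f q ≤ g p + g q) :
    ∑ x, f x ≤ ∑ x, g x := by
  rw [sum_eq_pair_add f hpq, sum_eq_pair_add g hpq]
  refine Nat.add_le_add h' (Finset.sum_le_sum fun x hx => ?_)
  rw [Finset.mem_erase, Finset.mem_erase] at hx
  exact (h x hx.2.1 hx.1).le

theorem sum_le_sum_of_involutive {W : Type*} [Fintype W] {f g : W → ℕ} {s : W → W}
    (hs : Function.Involutive s) (h : ∀ p, f p + f (s p) ≤ g p + g (s p)) :
    ∑ p, f p ≤ ∑ p, g p := by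
  have h1 : ∀ f : W → ℕ, ∑ p, (f p + f (s p)) = ∑ p, f p + ∑ p, f p := fun f => by
    rw [Finset.sum_add_distrib]
    congr 1
    exact Equiv.sum_comp (hs.toPerm s) f
  have h2 := Finset.sum_le_sum fun p (_ : p ∈ Finset.univ) => h p
  rw [h1, h1] at h2
  omega

namespace ExtremalSet

variable {ι : Type*} [LinearOrder ι] [Fintype ι] {V : ι → Type*} [∀ i, Fintype (V i)]
  {G : ∀ i, SimpleGraph (V i)} {η : ∀ i, Numbering (V i)} (E : ExtremalSet G η)

/-- Points move from the last slice larger than `Z` to the first one smaller than `Z`. Both lie in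
one segment, and the receiving vertex is later, so it has at least as many earlier neighbours. -/
theorem false_of_segment_eq (j : ι) (Z : ℕ) {p₀ q₀ : V j} (hp₀ : Z < E.size j p₀)
    (hq₀ : E.size j q₀ < Z)
    (hseg : (segment (G j) (η j) p₀).1 = (segment (G j) (η j) q₀).1)
    (hlt : ∀ p q a b, (segment (G j) (η j) p).1 = (segment (G j) (η j) p₀).1 →
      (segment (G j) (η j) q).1 = (segment (G j) (η j) p₀).1 →
      pos (E.num j) a ≤ Z → Z < pos (E.num j) b → SBL G η (ins j q a) (ins j p b)) : False := by
  obtain ⟨p, hp, hpmax⟩ := Finset.exists_max_image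
    (Finset.univ.filter fun x => Z < E.size j x) (pos (η j)) ⟨p₀, by simpa using hp₀⟩
  obtain ⟨q, hq, hqmin⟩ := Finset.exists_min_image
    (Finset.univ.filter fun x => E.size j x < Z) (pos (η j)) ⟨q₀, by simpa using hq₀⟩
  simp only [Finset.mem_filter, Finset.mem_univ, true_and] at hp hpmax hq hqmin
  have hpq : pos (η j) p < pos (η j) q := by
    by_contra hle
    have := E.size_anti j (not_lt.1 hle)
    omega
  have hne : p ≠ q := fun e => by simp [e] at hpq
  have h1 := hpmax p₀ hp₀
  have h2 := hqmin q₀ hq₀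
  have hsp := segment_fst_eq_of_between (E.optimal j) hseg h1 (hpq.le.trans h2)
  have hsq := segment_fst_eq_of_between (E.optimal j) hseg (h1.trans hpq.le) h2
  -- The largest transfer for which neither size crosses `Z`; one of the two then equals `Z`.
  obtain ⟨r, hr⟩ : ∃ r, r = Min.min (E.size j p - Z) (Z - E.size j q) := ⟨_, rfl⟩
  set M : V j → ℕ := fun x =>
    if x = p then E.size j p - r else if x = q then E.size j q + r else E.size j x with hM
  have hMp : M p = E.size j p - r := by simp [hM]
  have hMq : M q = E.size j q + r := by simp [hM, hne.symm]
  have hMx : ∀ x, x ≠ p → x ≠ q → M x = E.size j x := fun x h h' => by simp [hM, h, h']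
  -- The slices strictly between `p` and `q` have size exactly `Z`, so the new sizes still decrease
  -- and `sum_adj_min_eq` applies to them.
  have hanti : ∀ x y, pos (η j) x ≤ pos (η j) y → M y ≤ M x := by
    intro x y hxy
    have hs := E.size_anti j hxy
    have hgt : ∀ z, z ≠ p → pos (η j) p ≤ pos (η j) z → E.size j z ≤ Z := fun z hz hle => by
      by_contra hlt
      exact hz (pos_injective _ (le_antisymm (hpmax z (not_le.1 hlt)) hle))
    have hlt : ∀ z, z ≠ q → pos (η j) z ≤ pos (η j) q → Z ≤ E.size j z := fun z hz hle => by
      by_contra hlt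
      exact hz (pos_injective _ (le_antisymm hle (hqmin z (not_le.1 hlt))))
    by_cases hxp : x = p <;> by_cases hyp : y = p
    · rw [hxp, hyp]
    · subst hxp
      have := hgt y hyp hxy
      by_cases hyq : y = q
      · subst hyq
        omega
      · rw [hMx y hyp hyq]
        omega
    · subst hyp
      by_cases hxq : x = q
      · subst hxq
        omega
      · rw [hMx x hxp hxq]
        omega
    · by_cases hxq : x = q <;> by_cases hyq : y = q
      · rw [hxq, hyq]
      · subst hxq
        rw [hMx y hyp hyq]
        omega
      · subst hyq
        have := hlt x hxq hxy
        rw [hMx x hxp hxq]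
        omega
      · rwa [hMx x hxp hxq, hMx y hyp hyq]
  have hN := E.size_le j p
  refine E.false_of_exchange j Z M ?_ ?_ ?_ ?_ ?_ ?_ ?_ ⟨p, by omega⟩
  · intro x
    by_cases hxp : x = p
    · subst hxp; omega
    · by_cases hxq : x = q
      · subst hxq; omega
      · rw [hMx x hxp hxq]
        exact E.size_le j x
  · exact le_antisymm (sum_le_sum_of_pair hne hMx (by omega))
      (sum_le_sum_of_pair hne (fun x h h' => (hMx x h h').symm) (by omega))
  · intro x hx
    by_cases hxp : x = p
    · subst hxp; omega
    · by_cases hxq : x = q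
      · subst hxq; omega
      · rw [hMx x hxp hxq] at hx
        omega
  · intro x hx
    by_cases hxp : x = p
    · subst hxp; omega
    · by_cases hxq : x = q
      · subst hxq; omega
      · rw [hMx x hxp hxq] at hx
        omega
  · intro x y a b hx hy
    have hxp : x = p := by
      by_contra hxp
      by_cases hxq : x = q
      · subst hxq; omega
      · rw [hMx x hxp hxq] at hx
        omega
    have hyq : y = q := by
      by_contra hyq
      by_cases hyp : y = p
      · subst hyp; omega
      · rw [hMx y hyp hyq] at hy
        omega
    exact hlt x y a b (hxp ▸ hsp) (hyq ▸ hsq)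
  · refine sum_le_sum_of_pair hne (fun x h h' => by rw [hMx x h h']) ?_
    have h3 := E.adjCount_add_le j hq.le hp.le fun a b => hlt p q a b hsp hsq
    rw [hMp, hMq]
    rcases le_total (E.size j p - Z) (Z - E.size j q) with h | h
    · have e1 : E.size j p - r = Z := by omega
      have e2 : E.size j q + r = E.size j p + E.size j q - Z := by omega
      rw [e1, e2]
      omega
    · have e1 : E.size j p - r = E.size j p + E.size j q - Z := by omega
      have e2 : E.size j q + r = Z := by omega
      rw [e1, e2]
      omega
  · rw [sum_adj_min_eq (ζ := η j) hanti, sum_adj_min_eq (ζ := η j) fun x y => E.size_anti j]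
    refine Nat.mul_le_mul_left 2 (sum_le_sum_of_pair hne (fun x h h' => by rw [hMx x h h']) ?_)
    have hb := backDegree_le_of_segment_eq (E.optimal j) (hsp.trans hsq.symm) hpq.le
    rw [hMp, hMq]
    obtain ⟨s, hs⟩ : ∃ s, E.size j p = s + r := ⟨E.size j p - r, by omega⟩
    have := Nat.mul_le_mul_left r hb
    rw [hs, Nat.add_sub_cancel, Nat.add_mul, Nat.add_mul]
    omega

/-- Here `F` stands for the first segment and its mirror image for the last. All mirror pairs of
slices are exchanged at once, so that a loss between two slices of `F` is offset by the gain between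
their mirrors. -/
theorem false_of_mirror (j : ι) (Z : ℕ) (F : V j → Prop)
    (hZ : Z ≤ Fintype.card (∀ k : {k // k ≠ j}, V k))
    (hF : ∀ p, F p → Z ≤ E.size j p) (hF' : ∀ p, F p → E.size j (mirror (η j) p) ≤ Z)
    (hmid : ∀ p, ¬ F p → ¬ F (mirror (η j) p) → E.size j p = Z)
    (hdisj : ∀ p, F p → ¬ F (mirror (η j) p))
    (hadj : ∀ p q, F p → F q → p ≠ q → (G j).Adj (mirror (η j) p) (mirror (η j) q))
    (hlt : ∀ p q a b, F p → F (mirror (η j) q) →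
      pos (E.num j) a ≤ Z → Z < pos (E.num j) b → SBL G η (ins j q a) (ins j p b))
    (hne : ∃ p, F p ∧ Z < E.size j p ∧ E.size j (mirror (η j) p) < Z) : False := by
  set s := mirror (η j) with hs
  have hss : Function.Involutive s := mirror_mirror (η j)
  -- In each mirror pair one size becomes `Z` and the other takes the remainder; neither crosses
  -- `Z`.
  set M : V j → ℕ := fun p =>
    if F p then Max.max Z (E.size j p + E.size j (s p) - Z)
    else if F (s p) then Min.min Z (E.size j p + E.size j (s p) - Z) else E.size j p with hM
  have hM1 : ∀ p, F p → M p = Max.max Z (E.size j p + E.size j (s p) - Z) := fun p h => by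
    simp [hM, h]
  have hM2 : ∀ p, F p → M (s p) = Min.min Z (E.size j p + E.size j (s p) - Z) := fun p h => by
    simp [hM, hdisj p h, hss p, h, add_comm]
  have hM3 : ∀ p, ¬ F p → ¬ F (s p) → M p = E.size j p := fun p h h' => by simp [hM, h, h']
  have hcases : ∀ p, F p ∨ (∃ q, F q ∧ s q = p) ∨ (¬ F p ∧ ¬ F (s p)) := fun p => by
    by_cases h : F p
    · exact Or.inl h
    · by_cases h' : F (s p)
      · exact Or.inr (Or.inl ⟨s p, h', hss p⟩)
      · exact Or.inr (Or.inr ⟨h, h'⟩)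
  have hdouble : ∀ f : ℕ → ℕ, (∀ p, F p →
      f (M p) + f (M (s p)) = f Z + f (E.size j p + E.size j (s p) - Z)) := by
    intro f p hp
    rw [hM1 p hp, hM2 p hp]
    rcases le_total Z (E.size j p + E.size j (s p) - Z) with h | h
    · rw [max_eq_right h, min_eq_left h, add_comm]
    · rw [max_eq_left h, min_eq_right h]
  refine E.false_of_exchange j Z M ?_ ?_ ?_ ?_ ?_ ?_ ?_ ?_
  · intro p
    have := E.size_le j p
    rcases hcases p with h | ⟨q, h, rfl⟩ | ⟨h, h'⟩
    · have := hF' p h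
      rw [hM1 p h]
      omega
    · rw [hM2 q h]
      omega
    · rwa [hM3 p h h']
  · have key : ∀ p, M p + M (s p) = E.size j p + E.size j (s p) := by
      intro p
      rcases hcases p with h | ⟨q, h, rfl⟩ | ⟨h, h'⟩
      · have h1 := hdouble id p h
        have h2 := hF p h
        simp only [id] at h1
        omega
      · have h1 := hdouble id q h
        have h2 := hF q h
        simp only [id] at h1
        rw [hss q]
        omega
      · rw [hM3 p h h', hM3 (s p) h' (by rwa [hss p])]
    exact le_antisymm (sum_le_sum_of_involutive hss fun p => (key p).le)
      (sum_le_sum_of_involutive hss fun p => (key p).ge)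
  · intro p hp
    rcases hcases p with h | ⟨q, h, rfl⟩ | ⟨h, h'⟩
    · rw [hM1 p h]
      exact le_max_left _ _
    · have := hF q h
      have := hF' q h
      rw [hM2 q h] at hp
      omega
    · rw [hM3 p h h'] at hp
      omega
  · intro p hp
    rcases hcases p with h | ⟨q, h, rfl⟩ | ⟨h, h'⟩
    · have := hF p h
      have := hF' p h
      rw [hM1 p h] at hp
      omega
    · rw [hM2 q h]
      exact min_le_left _ _
    · rw [hM3 p h h'] at hp
      omega
  · intro p q a b hp hq
    have hp' : F p := by
      rcases hcases p with h | ⟨q, h, rfl⟩ | ⟨h, h'⟩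
      · exact h
      · have := hF q h
        have := hF' q h
        rw [hM2 q h] at hp
        omega
      · rw [hM3 p h h'] at hp
        omega
    have hq' : F (s q) := by
      rcases hcases q with h | ⟨q, h, rfl⟩ | ⟨h, h'⟩
      · have := hF q h
        have := hF' q h
        rw [hM1 q h] at hq
        omega
      · rwa [hss q]
      · rw [hM3 q h h'] at hq
        omega
    exact hlt p q a b hp' hq'
  · have key : ∀ p, F p → adjCount (cartesianProduct fun k : {k // k ≠ j} => G k)
          (initialSegment (E.num j) (E.size j p)) +
        adjCount (cartesianProduct fun k : {k // k ≠ j} => G k)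
          (initialSegment (E.num j) (E.size j (s p))) ≤
        adjCount (cartesianProduct fun k : {k // k ≠ j} => G k)
          (initialSegment (E.num j) (M p)) +
        adjCount (cartesianProduct fun k : {k // k ≠ j} => G k)
          (initialSegment (E.num j) (M (s p))) := by
      intro p h
      rw [hdouble (fun n => adjCount (cartesianProduct fun k : {k // k ≠ j} => G k)
          (initialSegment (E.num j) n)) p h, add_comm (adjCount _ (initialSegment _ Z))]
      exact E.adjCount_add_le j (hF' p h) (hF p h)
        fun a b => hlt p (s p) a b h (by rwa [hss p])
    refine sum_le_sum_of_involutive hss fun p => ?_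
    rcases hcases p with h | ⟨q, h, rfl⟩ | ⟨h, h'⟩
    · exact key p h
    · have := key q h
      rw [hss q]
      omega
    · rw [hM3 p h h', hM3 (s p) h' (by rwa [hss p])]
  -- The pair `(p, q)` is compared together with `(s p, s q)`. Only two slices of `F` can lose
  -- common points, and there `hadj` guarantees the compensating adjacency of the mirrors.
  · rw [← Fintype.sum_prod_type', ← Fintype.sum_prod_type']
    have hs2 : Function.Involutive (Prod.map s s) := fun x => by
      exact Prod.ext (hss x.1) (hss x.2)
    have hMF : ∀ p, F p → Z ≤ M p ∧ M p ≤ E.size j p ∧ E.size j (s p) ≤ M (s p) ∧ M (s p) ≤ Z ∧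
        M p + M (s p) = E.size j p + E.size j (s p) ∧ (M p = Z ∨ M (s p) = Z) := by
      intro p h
      have := hF p h
      have := hF' p h
      rw [hM1 p h, hM2 p h]
      omega
    have hMm : ∀ p, ¬ F p → ¬ F (s p) → M p = Z ∧ E.size j p = Z ∧ M (s p) = Z ∧
        E.size j (s p) = Z := by
      intro p h h'
      rw [hM3 p h h', hM3 (s p) h' (by rwa [hss p]), hmid p h h',
        hmid (s p) h' (by rwa [hss p])]
      simp
    refine sum_le_sum_of_involutive hs2 fun x => ?_
    obtain ⟨p, q⟩ := x
    simp only [Prod.map_fst, Prod.map_snd]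
    have hff : ∀ p q, F p → F q →
        ((if (G j).Adj p q then Min.min (E.size j p) (E.size j q) else 0) +
        if (G j).Adj (s p) (s q) then Min.min (E.size j (s p)) (E.size j (s q)) else 0) ≤
        (if (G j).Adj p q then Min.min (M p) (M q) else 0) +
        if (G j).Adj (s p) (s q) then Min.min (M (s p)) (M (s q)) else 0 := by
      intro p q hp hq
      by_cases hpq : p = q
      · subst hpq
        simp
      · have h1 := hMF p hp
        have h2 := hMF q hq
        rw [if_pos (hadj p q hp hq hpq), if_pos (hadj p q hp hq hpq)]
        split_ifs <;> omega
    rcases hcases p with hp | ⟨p', hp, rfl⟩ | ⟨hp, hp'⟩ <;>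
      rcases hcases q with hq | ⟨q', hq, rfl⟩ | ⟨hq, hq'⟩
    · exact hff p q hp hq
    · have h1 := hMF p hp
      have h2 := hMF q' hq
      rw [hss q']
      split_ifs <;> omega
    · have h1 := hMF p hp
      have h2 := hMm q hq hq'
      split_ifs <;> omega
    · have h1 := hMF p' hp
      have h2 := hMF q hq
      rw [hss p']
      split_ifs <;> omega
    · rw [hss p', hss q']
      have := hff p' q' hp hq
      omega
    · have h1 := hMF p' hp
      have h2 := hMm q hq hq'
      rw [hss p']
      split_ifs <;> omega
    · have h1 := hMm p hp hp'
      have h2 := hMF q hq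
      split_ifs <;> omega
    · have h1 := hMm p hp hp'
      have h2 := hMF q' hq
      rw [hss q']
      split_ifs <;> omega
    · have h1 := hMm p hp hp'
      have h2 := hMm q hq hq'
      split_ifs <;> omega
  · obtain ⟨p, h, h1, h2⟩ := hne
    refine ⟨p, ?_⟩
    rw [hM1 p h]
    omega

end ExtremalSet

/-! ### Excluding every kind of bad pair. -/

theorem exists_min_pair {ι : Type*} [LinearOrder ι] [Fintype ι]
    (hc : 3 ≤ Fintype.card ι) : ∃ i j : ι, (∀ k, i ≤ k) ∧ j ≠ i ∧ ∀ k, k ≠ i → j ≤ k := by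
  have : Nonempty ι := Fintype.card_pos_iff.1 (by omega)
  obtain ⟨i, -, hi⟩ := Finset.exists_min_image (Finset.univ : Finset ι) id Finset.univ_nonempty
  obtain ⟨l, hl, -⟩ := exists_ne_ne hc i i
  obtain ⟨j, hj, hjmin⟩ := Finset.exists_min_image (Finset.univ.erase i) id
    ⟨l, Finset.mem_erase.2 ⟨hl, Finset.mem_univ l⟩⟩
  exact ⟨i, j, fun k => hi k (Finset.mem_univ k), (Finset.mem_erase.1 hj).1,
    fun k hk => hjmin k (Finset.mem_erase.2 ⟨hk, Finset.mem_univ k⟩)⟩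

theorem exists_threshold {W : Type*} [Fintype W] (ζ : Numbering W) {T : W → Prop}
    (hT : ∀ a b, pos ζ a < pos ζ b → T b → T a) :
    ∃ Z ≤ Fintype.card W, ∀ a, pos ζ a ≤ Z ↔ T a := by
  by_cases h : ∃ a, T a
  · obtain ⟨c, hc, hmax⟩ := Finset.exists_max_image (Finset.univ.filter T) (pos ζ)
      (by simpa [Finset.Nonempty] using h)
    simp only [Finset.mem_filter, Finset.mem_univ, true_and] at hc hmax
    refine ⟨pos ζ c, pos_le_card ζ c, fun a => ⟨fun ha => ?_, hmax a⟩⟩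
    rcases ha.lt_or_eq with ha | ha
    · exact hT a c ha hc
    · rwa [pos_injective ζ ha]
  · refine ⟨0, Nat.zero_le _, fun a => ⟨fun ha => ?_, fun ha => (h ⟨a, ha⟩).elim⟩⟩
    have := one_le_pos ζ a
    omega

theorem starts_ins {ι : Type*} [LinearOrder ι] {V : ι → Type*} [∀ i, Fintype (V i)]
    {G : ∀ i, SimpleGraph (V i)} {η : ∀ i, Numbering (V i)} {j : ι} {p q : V j}
    (h : (segment (G j) (η j) p).1 = (segment (G j) (η j) q).1)
    (a : ∀ k : {k // k ≠ j}, V k) :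
    starts G η (ins j p a) = starts G η (ins j q a) := by
  funext i
  by_cases hi : i = j
  · subst hi
    simpa only [starts, ins_self] using h
  · simp only [starts, ins_of_ne hi]

namespace ExtremalSet

variable {ι : Type*} [LinearOrder ι] [Fintype ι] {V : ι → Type*} [∀ i, Fintype (V i)]
  {G : ∀ i, SimpleGraph (V i)} {η : ∀ i, Numbering (V i)} (E : ExtremalSet G η)

theorem size_lt_of_notMem {j : ι} {Z : ℕ} {u : ∀ i, V i} (hu : u ∉ E.A)
    (h : pos (E.num j) (rest j u) ≤ Z) : E.size j (u j) < Z := by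
  rw [E.mem_iff j] at hu
  omega

theorem lt_size_of_mem {j : ι} {Z : ℕ} {v : ∀ i, V i} (hv : v ∈ E.A)
    (h : Z < pos (E.num j) (rest j v)) : Z < E.size j (v j) := by
  rw [E.mem_iff j] at hv
  omega

theorem sbl_ins (j : ι) (p : V j) {a b : ∀ k : {k // k ≠ j}, V k}
    (h : pos (E.num j) a < pos (E.num j) b) : SBL G η (ins j p a) (ins j p b) := by
  rw [← E.num_rest_lt (j := j) (by rw [ins_self, ins_self]), rest_ins, rest_ins]
  exact h

/-- Cut the slice order just after the block of `u`. Within the common segment of `u j` and `v j`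
the cut does not depend on the slice, so everything up to it precedes everything beyond it, across
slices. -/
theorem false_of_starts_eq_at {u v : ∀ i, V i} (hu : u ∉ E.A) (hv : v ∈ E.A) {j : ι}
    (hj : starts G η u j = starts G η v j) (hlt : LexLT (starts G η u) (starts G η v)) : False := by
  have hη := E.optimal
  obtain ⟨Z, -, hZ⟩ := exists_threshold (E.num j)
    (T := fun a => ¬ LexLT (starts G η u) (starts G η (ins j (u j) a))) (by
      intro a b hab hb ha
      refine hb ?_
      rcases (sbl_iff hη _ _).1 (E.sbl_ins j (u j) hab) with h | ⟨h, -⟩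
      · exact lex_trans lt_trans lt_trichotomy ha h
      · rwa [← h])
  have hZu : pos (E.num j) (rest j u) ≤ Z := by
    rw [hZ, ins_rest]
    exact lex_irrefl
  have hZv : Z < pos (E.num j) (rest j v) := by
    rw [← not_le, hZ, not_not, starts_ins (q := v j) hj, ins_rest]
    exact hlt
  refine E.false_of_segment_eq j Z (E.lt_size_of_mem hv hZv) (E.size_lt_of_notMem hu hZu) hj.symm ?_
  intro p q a b hp hq ha hb
  have hp' : (segment (G j) (η j) p).1 = (segment (G j) (η j) (u j)).1 := hp.trans hj.symm
  have hq' : (segment (G j) (η j) q).1 = (segment (G j) (η j) (u j)).1 := hq.trans hj.symm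
  rw [hZ] at ha
  rw [← not_le, hZ, not_not] at hb
  refine sbl_of_starts_lt hη ?_
  rw [starts_ins hp', starts_ins hq']
  by_cases h : starts G η (ins j (u j) a) = starts G η u
  · rwa [h]
  · exact lex_trans lt_trans lt_trichotomy
      ((lex_trichotomous (r := fun i k : ι => i < k) lt_trans lt_irrefl h).resolve_right ha) hb

/-- As `u` and `v` share no coordinate, the first coordinate `m` of the domination order decides
between them. The cut is made inside their block, by the value of coordinate `m`, and any `j ≠ m`
serves as slicing direction. -/
theorem false_of_starts_eq {u v : ∀ i, V i} (hu : u ∉ E.A) (hv : v ∈ E.A)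
    (hst : starts G η u = starts G η v)
    (hlt : DominationLT (sides G η u) (coords η u) (coords η v)) : False := by
  have hη := E.optimal
  have huv : SBL G η u v := (sbl_iff hη u v).2 (Or.inr ⟨hst, hlt⟩)
  obtain ⟨m, hm, hmlt⟩ := hlt
  have hmin : ∀ k, ¬ sideLT (sides G η u) k m := fun k hk =>
    E.not_sbl_of_eq hu hv (pos_injective (η k) (hm k hk)) huv
  obtain ⟨j, hjm, -⟩ := exists_ne_ne E.card_index m m
  have hj := congrFun hst j
  set x : (∀ k : {k // k ≠ j}, V k) → ∀ i, V i := fun a => ins j (u j) a with hx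
  have hxu : x (rest j u) = u := ins_rest j u
  have hcx : ∀ p a, coords η (ins j p a) m = coords η (x a) m := fun p a => by
    simp only [hx, coords, ins_of_ne (Ne.symm hjm)]
  obtain ⟨Z, -, hZ⟩ := exists_threshold (E.num j)
    (T := fun a => LexLT (starts G η (x a)) (starts G η u) ∨
      starts G η (x a) = starts G η u ∧ coords η (x a) m ≤ coords η u m) (by
      intro a b hab hb
      rcases (sbl_iff hη _ _).1 (E.sbl_ins j (u j) hab) with h | ⟨h, i, hi, hilt⟩
      · rcases hb with hb | ⟨hb, -⟩
        · exact Or.inl (lex_trans lt_trans lt_trichotomy h hb)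
        · exact Or.inl (hb ▸ h)
      · rcases hb with hb | ⟨hb, hb'⟩
        · exact Or.inl (h ▸ hb)
        · refine Or.inr ⟨h.trans hb, le_trans ?_ hb'⟩
          have hs : sides G η (ins j (u j) a) = sides G η u := sides_eq hη (h.trans hb)
          rw [hs] at hi
          rcases sideLT_trichotomous (n := sides G η u) m i with hmi | rfl | hmi
          · exact (hi m hmi).le
          · exact hilt.le
          · exact (hmin i hmi).elim)
  have hZu : pos (E.num j) (rest j u) ≤ Z := by
    rw [hZ, hxu]
    exact Or.inr ⟨rfl, le_rfl⟩
  have hZv : Z < pos (E.num j) (rest j v) := by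
    have hs : starts G η (x (rest j v)) = starts G η v := by
      rw [← ins_rest j v, rest_ins]
      exact starts_ins hj _
    rw [← not_le, hZ, ← hcx (v j), hs, ins_rest, ← hst]
    rintro (h | ⟨-, h⟩)
    · exact lex_irrefl h
    · exact absurd h (not_le.2 hmlt)
  refine E.false_of_segment_eq j Z (E.lt_size_of_mem hv hZv) (E.size_lt_of_notMem hu hZu) hj.symm ?_
  intro p q a b hp hq ha hb
  have hp' : (segment (G j) (η j) p).1 = (segment (G j) (η j) (u j)).1 := hp.trans hj.symm
  have hq' : (segment (G j) (η j) q).1 = (segment (G j) (η j) (u j)).1 := hq.trans hj.symm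
  rw [hZ] at ha
  rw [← not_le, hZ, not_or, not_and, not_le] at hb
  rw [sbl_iff hη, starts_ins hp', starts_ins hq']
  by_cases hbu : starts G η (x b) = starts G η u
  · rcases ha with ha | ⟨ha, ha'⟩
    · exact Or.inl (hbu ▸ ha)
    · refine Or.inr ⟨ha.trans hbu.symm, m, fun k hk => ?_, ?_⟩
      · rw [sides_eq hη ((starts_ins hq' a).trans ha)] at hk
        exact (hmin k hk).elim
      · rw [hcx q a, hcx p b]
        exact lt_of_le_of_lt ha' (hb.2 hbu)
  · have hb' := (lex_trichotomous (r := fun i k : ι => i < k) lt_trans lt_irrefl hbu).resolve_left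
      hb.1
    rcases ha with ha | ⟨ha, -⟩
    · exact Or.inl (lex_trans lt_trans lt_trichotomy ha hb')
    · exact Or.inl (ha ▸ hb')

theorem snd_segment_eq_card {u v : ∀ i, V i} (hu : u ∉ E.A) (hv : v ∈ E.A) {i j : ι}
    (hi : ∀ k, i ≤ k) (hij : j ≠ i) (hj : ∀ k, k ≠ i → j ≤ k)
    (hlt : starts G η u i < starts G η v i) :
    (segment (G j) (η j) (u j)).2 = Fintype.card (V j) := by
  have hη := E.optimal
  obtain ⟨h1, h2, h3⟩ := segment_spec (hη j) (u j)
  by_contra hne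
  have hcard := h1.2.2.1
  have hpos := one_le_pos (η j) (u j)
  obtain ⟨w, hw⟩ := exists_pos_eq (η j) (m := Fintype.card (V j)) (by omega) le_rfl
  have hjw : (segment (G j) (η j) (u j)).1 < (segment (G j) (η j) w).1 := by
    refine lt_of_le_of_ne (segment_fst_mono (hη j) (by omega)) fun he => ?_
    have h4 := segment_spec (hη j) w
    rw [← segment_eq_of_fst_eq (hη j) he] at h4
    omega
  obtain ⟨k, hkj, hki⟩ := exists_ne_ne E.card_index j i
  -- A point strictly between `u` and `v` that shares coordinate `i` with `u` and `k` with `v`;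
  -- whether or not it lies in `A`, one of the two comparisons is impossible.
  set t := Function.update (Function.update v i (u i)) j w with ht
  have hti : t i = u i := by simp [ht, hij.symm]
  have htj : t j = w := by simp [ht]
  have htk : t k = v k := by simp [ht, hkj, hki]
  have hut : SBL G η u t := by
    refine sbl_of_starts_lt hη ⟨j, fun l hl => ?_, ?_⟩
    · have hli : l = i := by
        by_contra hli
        exact absurd hl (not_lt.2 (hj l hli))
      subst hli
      simp only [starts, hti]
    · simpa only [starts, htj] using hjw
  have htv : SBL G η t v := by
    refine sbl_of_starts_lt hη ⟨i, fun l hl => absurd hl (not_lt.2 (hi l)), ?_⟩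
    simpa only [starts, hti] using hlt
  by_cases htA : t ∈ E.A
  · exact E.not_sbl_of_eq hu htA hti.symm hut
  · exact E.not_sbl_of_eq htA hv htk htv

theorem fst_segment_eq_one {u v : ∀ i, V i} (hu : u ∉ E.A) (hv : v ∈ E.A) {i j : ι}
    (hi : ∀ k, i ≤ k) (hij : j ≠ i) (hj : ∀ k, k ≠ i → j ≤ k)
    (hlt : starts G η u i < starts G η v i) :
    (segment (G j) (η j) (v j)).1 = 1 := by
  have hη := E.optimal
  obtain ⟨h1, h2, h3⟩ := segment_spec (hη j) (v j)
  by_contra hne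
  have hone := h1.1
  have hpos := pos_le_card (η j) (v j)
  obtain ⟨w, hw⟩ := exists_pos_eq (η j) (m := 1) le_rfl (by omega)
  have hjw : (segment (G j) (η j) w).1 < (segment (G j) (η j) (v j)).1 := by
    have h4 := segment_spec (hη j) w
    omega
  obtain ⟨k, hkj, hki⟩ := exists_ne_ne E.card_index j i
  set t := Function.update (Function.update u i (v i)) j w with ht
  have hti : t i = v i := by simp [ht, hij.symm]
  have htj : t j = w := by simp [ht]
  have htk : t k = u k := by simp [ht, hkj, hki]
  have hut : SBL G η u t := by
    refine sbl_of_starts_lt hη ⟨i, fun l hl => absurd hl (not_lt.2 (hi l)), ?_⟩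
    simpa only [starts, hti] using hlt
  have htv : SBL G η t v := by
    refine sbl_of_starts_lt hη ⟨j, fun l hl => ?_, ?_⟩
    · have hli : l = i := by
        by_contra hli
        exact absurd hl (not_lt.2 (hj l hli))
      subst hli
      simp only [starts, hti]
    · simpa only [starts, htj] using hjw
  by_cases htA : t ∈ E.A
  · exact E.not_sbl_of_eq hu htA htk.symm hut
  · exact E.not_sbl_of_eq htA hv hti htv

/-- With `i`, `j` the two least indices, the slices in direction `j` are cut according to the `i`-th
start. Slices larger than the cut occur only over the first segment of `G j`, smaller ones only over
the last, and regularity makes these mirror images. -/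
theorem false_of_starts_ne (hreg : ∀ i, ∃ k, HasDegree (G i) k) {u v : ∀ i, V i} (hu : u ∉ E.A)
    (hv : v ∈ E.A) (hne : ∀ i, starts G η u i ≠ starts G η v i)
    (hlt : LexLT (starts G η u) (starts G η v)) : False := by
  have hη := E.optimal
  obtain ⟨i, j, hi, hij, hj⟩ := exists_min_pair E.card_index
  obtain ⟨d, hd⟩ := hreg j
  have hlti : starts G η u i < starts G η v i := by
    obtain ⟨l, hl, hl'⟩ := hlt
    rcases (hi l).eq_or_lt with rfl | h
    · exact hl'
    · exact (hne i (hl i h)).elim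
  have hsi : ∀ p a, starts G η (ins j p a) i = (segment (G i) (η i) (a ⟨i, hij.symm⟩)).1 :=
    fun p a => by rw [starts, ins_of_ne hij.symm]
  obtain ⟨Z, hZN, hZ⟩ := exists_threshold (E.num j)
    (T := fun a => (segment (G i) (η i) (a ⟨i, hij.symm⟩)).1 ≤ starts G η u i) (by
      intro a b hab hb
      refine le_trans ?_ hb
      rw [← hsi (u j) a, ← hsi (u j) b]
      rcases (sbl_iff hη _ _).1 (E.sbl_ins j (u j) hab) with ⟨l, hl, hl'⟩ | ⟨h, -⟩
      · rcases (hi l).eq_or_lt with rfl | h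
        · exact hl'.le
        · exact (hl i h).le
      · rw [h])
  have hZu : pos (E.num j) (rest j u) ≤ Z := (hZ _).2 le_rfl
  have hZv : Z < pos (E.num j) (rest j v) := by
    rw [← not_le, hZ, not_le]
    exact hlti
  have hsv := E.lt_size_of_mem hv hZv
  have hsu := E.size_lt_of_notMem hu hZu
  -- The first missing point of such a slice is still within the cut, so it forms a bad pair with
  -- `v` and can replace `u`.
  have key1 : ∀ p, E.size j p < Z → (segment (G j) (η j) p).2 = Fintype.card (V j) := by
    intro p hp
    obtain ⟨a, ha⟩ := exists_pos_eq (E.num j) (m := E.size j p + 1) (by omega) (by omega)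
    have hmem : ins j p a ∉ E.A := by
      rw [E.mem_iff j, rest_ins, ins_self]
      omega
    have h := E.snd_segment_eq_card hmem hv hi hij hj (by
      rw [hsi]
      exact lt_of_le_of_lt ((hZ a).1 (by omega)) hlti)
    rwa [ins_self] at h
  have key2 : ∀ p, Z < E.size j p → (segment (G j) (η j) p).1 = 1 := by
    intro p hp
    have hN := E.size_le j p
    obtain ⟨a, ha⟩ := exists_pos_eq (E.num j) (m := Z + 1) (by omega) (by omega)
    have hmem : ins j p a ∈ E.A := by
      rw [E.mem_iff j, rest_ins, ins_self]
      omega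
    have h := E.fst_segment_eq_one hu hmem hi hij hj (by
      rw [hsi, ← not_le, ← hZ]
      omega)
    rwa [ins_self] at h
  -- The first and last segments are distinct; otherwise `u` and `v` would have the same `j`-th
  -- start.
  have hsingle : ∀ p, (segment (G j) (η j) p).1 = 1 →
      (segment (G j) (η j) p).2 = Fintype.card (V j) → False := by
    intro p h1 h2
    have h3 := (segment_spec (hη j) p).1
    rw [h1, h2] at h3
    apply hne j
    rw [starts, starts, segment_eq (hη j) h3 (one_le_pos _ _) (pos_le_card _ _),
      segment_eq (hη j) h3 (one_le_pos _ _) (pos_le_card _ _)]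
  have hmir : ∀ p, (segment (G j) (η j) (mirror (η j) p)).1 = 1 ↔
      (segment (G j) (η j) p).2 = Fintype.card (V j) := by
    intro p
    have := (segment_spec (hη j) p).1.2.2.1
    rw [segment_mirror hd (hη j)]
    simp only
    omega
  have hmir' : ∀ p, (segment (G j) (η j) (mirror (η j) p)).2 = Fintype.card (V j) ↔
      (segment (G j) (η j) p).1 = 1 := by
    intro p
    rw [← hmir, mirror_mirror]
  have hcard := pos_le_card (η j) (u j)
  have hone := one_le_pos (η j) (u j)
  obtain ⟨w, hw⟩ := exists_pos_eq (η j) (m := 1) le_rfl (by omega)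
  refine E.false_of_mirror j Z (fun p => (segment (G j) (η j) p).1 = 1) hZN ?_ ?_ ?_ ?_ ?_ ?_
    ⟨w, ?_, ?_, ?_⟩
  · intro p hp
    by_contra hlt
    exact hsingle p hp (key1 p (not_le.1 hlt))
  · intro p hp
    by_contra hlt
    exact hsingle _ (key2 _ (not_le.1 hlt)) ((hmir' p).2 hp)
  · intro p hp hp'
    rw [hmir] at hp'
    by_contra hne
    rcases lt_or_gt_of_ne hne with h | h
    · exact hp' (key1 p h)
    · exact hp (key2 p h)
  · intro p hp hp'
    exact hsingle p hp ((hmir p).1 hp')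
  · intro p q hp hq hpq
    refine adj_of_segment_eq (hη j) (fun e => hpq (mirror_injective _ e)) ?_
    rw [segment_mirror hd (hη j), segment_mirror hd (hη j),
      segment_eq_of_fst_eq (hη j) (hp.trans hq.symm)]
  · intro p q a b _ _ ha hb
    refine sbl_of_starts_lt hη ⟨i, fun l hl => absurd hl (not_lt.2 (hi l)), ?_⟩
    rw [hsi, hsi]
    rw [hZ] at ha
    rw [← not_le, hZ, not_le] at hb
    exact lt_of_le_of_lt ha hb
  · have h1 := segment_spec (hη j) w
    have := h1.1.1
    omega
  · have := E.size_anti j (p := w) (q := v j) (by have := one_le_pos (η j) (v j); omega)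
    omega
  · have := E.size_anti j (p := u j) (q := mirror (η j) w) (by rw [pos_mirror]; omega)
    omega

theorem eq_initialSegment (hreg : ∀ i, ∃ k, HasDegree (G i) k) :
    E.A = initialSegment E.all E.A.card := by
  have hbad : ∀ u v, u ∉ E.A → v ∈ E.A → ¬ SBL G η u v := by
    intro u v hu hv huv
    rcases (sbl_iff E.optimal u v).1 huv with h | ⟨h, h'⟩
    · by_cases hj : ∃ j, starts G η u j = starts G η v j
      · obtain ⟨j, hj⟩ := hj
        exact E.false_of_starts_eq_at hu hv hj h
      · exact E.false_of_starts_ne hreg hu hv (not_exists.1 hj) h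
    · exact E.false_of_starts_eq hu hv h h'
  obtain ⟨Z, hZN, hZ⟩ := exists_threshold E.all (T := fun x => x ∈ E.A) (by
    intro u v huv hv
    by_contra hu
    exact hbad u v hu hv ((E.all_lt u v).2 huv))
  have hA : E.A = initialSegment E.all Z := by
    ext x
    rw [mem_initialSegment, hZ]
  have hc : E.A.card = Z := by
    rw [hA, card_initialSegment _ hZN]
  rw [hc]
  exact hA

end ExtremalSet

/-! ### Induction on the number of factors. -/

theorem isOptimalOrder_of_rest {ι : Type*} [LinearOrder ι] [Fintype ι] {V : ι → Type*}
    [∀ i, Fintype (V i)] {G : ∀ i, SimpleGraph (V i)} {η : ∀ i, Numbering (V i)}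
    (hη : ∀ i, IsOptimalNumbering (G i) (η i)) (hreg : ∀ i, ∃ k, HasDegree (G i) k)
    (hcard : 3 ≤ Fintype.card ι)
    (hrest : ∀ j : ι, IsOptimalOrder (cartesianProduct fun k : {k // k ≠ j} => G k)
      (SBL (fun k : {k // k ≠ j} => G k) (fun k : {k // k ≠ j} => η k))) :
    IsOptimalOrder (cartesianProduct G) (SBL G η) := by
  choose ζ hζ hζlt using hrest
  obtain ⟨ξ, hξ⟩ := exists_numbering (r := SBL G η) (sbl_irrefl hη) (sbl_trans hη)
    (sbl_trichotomous hη)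
  refine ⟨ξ, (isOptimalNumbering_iff _ _).2 fun B => ?_, hξ⟩
  obtain ⟨A₁, hA₁, hmax⟩ := Finset.exists_max_image (Finset.powersetCard B.card Finset.univ)
    (adjCount (cartesianProduct G)) ⟨B, Finset.mem_powersetCard.2 ⟨Finset.subset_univ B, rfl⟩⟩
  obtain ⟨A, hA, hmin⟩ := Finset.exists_min_image
    ((Finset.powersetCard B.card Finset.univ).filter fun C =>
      adjCount (cartesianProduct G) A₁ ≤ adjCount (cartesianProduct G) C)
    (fun C => ∑ x ∈ C, pos ξ x) ⟨A₁, Finset.mem_filter.2 ⟨hA₁, le_rfl⟩⟩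
  simp only [Finset.mem_filter, Finset.mem_powersetCard, Finset.subset_univ, true_and]
    at hmax hmin hA
  let E : ExtremalSet G η :=
    { optimal := hη
      num := ζ
      num_optimal := hζ
      num_lt := hζlt
      all := ξ
      all_lt := hξ
      A := A
      max := fun C hC => (hmax C (hC.trans hA.1)).trans hA.2
      min := fun C hC hle => hmin C ⟨hC.trans hA.1, hA.2.trans hle⟩
      card_index := hcard }
  have h := E.eq_initialSegment hreg
  change A = initialSegment ξ A.card at h
  rw [hA.1] at h
  rw [← h]
  exact (hmax B rfl).trans hA.2
end EdgeIso

namespace EdgeIso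

section Reindex

variable {ι κ : Type*} [LinearOrder ι] [LinearOrder κ] {V : ι → Type*} [∀ i, Fintype (V i)]
  {G : ∀ i, SimpleGraph (V i)} {η : ∀ i, Numbering (V i)}

/-- The `Fintype` instances on the products are arbitrary, so that the lemma applies however they
were built. -/
theorem isOptimalOrder_comp_iff (hη : ∀ i, IsOptimalNumbering (G i) (η i)) (f : κ ≃o ι)
    [Fintype (∀ i, V i)] [Fintype (∀ k, V (f k))] :
    IsOptimalOrder (cartesianProduct fun k => G (f k))
        (SBL (fun k => G (f k)) fun k => η (f k)) ↔
      IsOptimalOrder (cartesianProduct G) (SBL G η) := by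
  let e : (∀ i, V i) ≃ (∀ k, V (f k)) := (Equiv.piCongrLeft V f.toEquiv).symm
  have hadj : ∀ u v, (cartesianProduct fun k => G (f k)).Adj (e u) (e v) ↔
      (cartesianProduct G).Adj u v := fun u v => by
    change (∃ k, (G (f k)).Adj (u (f k)) (v (f k)) ∧ ∀ l, l ≠ k → u (f l) = v (f l)) ↔
      ∃ i, (G i).Adj (u i) (v i) ∧ ∀ j, j ≠ i → u j = v j
    rw [f.surjective.exists]
    refine exists_congr fun k => and_congr_right fun _ => ?_
    rw [f.surjective.forall]
    simp only [ne_eq, f.injective.eq_iff]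
  have hr : ∀ u v, SBL (fun k => G (f k)) (fun k => η (f k)) (e u) (e v) ↔ SBL G η u v :=
    fun u v => sbl_comp_iff hη f.toOrderEmbedding fun i hi => (hi (f.surjective i)).elim
  refine ⟨fun h => h.transfer e.symm (fun u v => ?_) fun u v => ?_, fun h => h.transfer e hadj hr⟩
  · rw [← hadj, e.apply_symm_apply, e.apply_symm_apply]
  · rw [← hr, e.apply_symm_apply, e.apply_symm_apply]

end Reindex

theorem hasDegree_of_isRegularOfDegree {V : Type*} [Fintype V] {G : SimpleGraph V}
    [DecidableRel G.Adj] {k : ℕ} (h : G.IsRegularOfDegree k) : HasDegree G k := by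
  intro x
  rw [← h x, ← SimpleGraph.card_neighborFinset_eq_degree, SimpleGraph.neighborFinset_eq_filter,
    Finset.card_filter]
  exact Finset.sum_congr rfl fun y _ => by split_ifs <;> rfl

/-- The indices in `S` other than `j` are the indices in `S.erase j`. -/
def eraseOrderIso {ι : Type*} [LinearOrder ι] (S : Finset ι) (j : S) :
    {k : S // k ≠ j} ≃o (S.erase j : Finset ι) where
  toFun k := ⟨k.1, Finset.mem_erase.2 ⟨fun h => k.2 (Subtype.ext h), k.1.2⟩⟩
  invFun k := ⟨⟨k, Finset.mem_of_mem_erase k.2⟩,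
    fun h => Finset.ne_of_mem_erase k.2 (congrArg Subtype.val h)⟩
  left_inv _ := rfl
  right_inv _ := rfl
  map_rel_iff' := Iff.rfl

theorem isOptimalOrder_finset {ι : Type*} [LinearOrder ι] {V : ι → Type*} [∀ i, Fintype (V i)]
    {G : ∀ i, SimpleGraph (V i)} {η : ∀ i, Numbering (V i)}
    (hη : ∀ i, IsOptimalNumbering (G i) (η i)) (hreg : ∀ i, ∃ k, HasDegree (G i) k)
    (hpair : ∀ i j : ι, i < j →
      IsOptimalOrder (cartesianProduct fun k : ({i, j} : Finset ι) => G k)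
        (SBL (fun k : ({i, j} : Finset ι) => G k) (fun k => η k))) (S : Finset ι)
    (hS : 2 ≤ S.card) :
    IsOptimalOrder (cartesianProduct fun k : S => G k) (SBL (fun k : S => G k) fun k => η k) := by
  induction hn : S.card generalizing S with
  | zero => omega
  | succ n ih =>
    rcases hS.eq_or_lt with h | h
    · obtain ⟨i, j, hij, rfl⟩ := Finset.card_eq_two.1 h.symm
      rcases lt_or_gt_of_ne hij with hlt | hlt
      · exact hpair i j hlt
      · rw [Finset.pair_comm]
        exact hpair j i hlt
    · have hc : 3 ≤ Fintype.card S := by rwa [Fintype.card_coe]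
      convert isOptimalOrder_of_rest (fun k : S => hη k) (fun k : S => hreg k) hc fun j => ?_
      have hj : (S.erase j).card = n := by
        rw [Finset.card_erase_of_mem j.2]
        omega
      exact (isOptimalOrder_comp_iff (fun k : (S.erase j : Finset ι) => hη k)
        (eraseOrderIso S j)).2 (ih (S.erase j) (by omega) hj)

end EdgeIso

theorem mainTheorem3 (d : ℕ) (hd : 3 ≤ d) (V : Fin d → Type*) [∀ i, Fintype (V i)]
    (G : ∀ i, SimpleGraph (V i)) [∀ i, DecidableRel (G i).Adj]
    (hreg : ∀ i, ∃ k, (G i).IsRegularOfDegree k)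
    (η : ∀ i, EdgeIso.Numbering (V i))
    (hη : ∀ i, EdgeIso.IsOptimalNumbering (G i) (η i))
    (hpair : ∀ i j : Fin d, i < j →
      EdgeIso.IsOptimalOrder
        (EdgeIso.cartesianProduct fun k : ({i, j} : Finset (Fin d)) => G k)
        (EdgeIso.SBL (fun k : ({i, j} : Finset (Fin d)) => G k) (fun k => η k))) :
    EdgeIso.IsOptimalOrder (EdgeIso.cartesianProduct G) (EdgeIso.SBL G η) := by
  let f : ((Finset.univ : Finset (Fin d)) : Type) ≃o Fin d :=
    { Equiv.subtypeUnivEquiv Finset.mem_univ with map_rel_iff' := Iff.rfl }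
  refine (EdgeIso.isOptimalOrder_comp_iff hη f).1 (EdgeIso.isOptimalOrder_finset hη
    (fun i => (hreg i).imp fun _ => EdgeIso.hasDegree_of_isRegularOfDegree) (fun i j hij => ?_)
    Finset.univ (by rw [Finset.card_univ, Fintype.card_fin]; omega))
  convert hpair i j hij
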